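/- **Setting.** Fix $L\in\mathbb N$. For every sample size $N$ let $p=p_N$, $D=D_N\ge 1$, $J=J_N$, $M=M_N$ be natural numbers, and let $\{p_\phi:\phi\in\Phi_N\}$, with $\Phi_N\subset\mathbb R^{p}$ open, be a parametric family of probability densities on $\mathbb R^{D}$ with respect to a $\sigma$-finite measure. Let $s_\phi(x)=\nabla_\phi\log p_\phi(x)$, let $I(\phi)=\mathbb E_{x\sim p_\phi}[s_\phi(x)s_\phi(x)^T]$ be the Fisher information, and let $\Sigma_\phi=I(\phi)/D$ (the covariance matrix of the normalized score $\tilde x=D^{-1/2}s_\phi(x)$, $x\sim p_\phi$, when the score is centred). Let $\eta$ be an $\mathbb R^J$-valued nuisance functional of distributions, and let the estimating equations be linear, $g(x,\eta(p_\phi),\theta)=m(x,\eta(p_\phi))-\theta$, with $m(x,e)\in\mathbb R^L$ and $m(\cdot,\eta(p_\phi))$ integrable under $p_\phi$. Put $\psi(\phi)=\mathbb E_{x\sim p_\phi}[m(x,\eta(p_\phi))]$ and $\mu_\theta(\phi)=\mathbb E_{x\sim p_\phi}[g(x,\eta(p_\phi),\theta)]$. The data $x_1,\dots,x_N$ are i.i.d.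 from $\mathbb P^*=\mathbb P^*_N$, $\phi^*\in\Phi_N$ minimizes the Kullback–Leibler divergence of $\mathbb P^*$ from $p_\phi$ (so $p_{\phi^*}=\mathbb P^*$ if the model is well specified), and $\theta^*=\theta_N^*$ is the unique solution of $\mathbb E_{x\sim p_{\phi^*}}[g(x,\eta(p_{\phi^*}),\theta)]=0$. The initial estimate $\hat\phi\in\Phi_N$ is computed, possibly with extra randomness, from $x_1,\dots,x_{\lfloor N/2\rfloor}$. Given the data and $\hat\phi$, a Monte Carlo procedure run at $\hat\phi$ returns i.i.d. draws $y_1,\dots,y_M\sim p_{\hat\phi}$ and a random $L\times p$ matrix $[\nabla_\phi\hat\psi_M(\hat\phi)]^T$, an estimate of the Jacobian $[\nabla_\phi\psi(\hat\phi)]^T$, used as the estimate of $[\nabla_\phi\mu_\theta(\hat\phi)]^T$ for every $\theta$ since $\mu_\theta=\psi-\theta$; the dependence between draws and matrix is arbitrary. **Estimators.** Let $\varphi_\phi(x,\theta)=[\nabla_\phi\mu_\theta(\phi)]^TI(\phi)^{-1}s_\phi(x)$ and $$\hat\varphi_{\phi,M}(x,\theta)=[\nabla_\phi\hat\psi_M(\phi)]^T\hat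 I_M(\phi)^{-1}s_\phi(x),\qquad \hat I_M(\phi)=\frac1M\sum_{k=1}^M s_\phi(y_k)s_\phi(y_k)^T .$$ The MC-EIF debiased/double-ML estimator returns $\{\theta:f(\theta)=0\}$ with $$f(\theta)=\frac2N\sum_{n=\lfloor N/2\rfloor+1}^N\bigl[g(x_n,\eta(p_{\hat\phi}),\theta)+\hat\varphi_{\hat\phi,M}(x_n,\theta)\bigr],$$ and the analytic DML estimator is obtained by replacing $\hat\varphi_{\hat\phi,M}$ by $\varphi_{\hat\phi}$. **Assumptions.** There are constants $0<C_1<\infty$ and $C_2,C_3,C_\psi<\infty$, independent of $N$ (hence of $p$ and $D$), such that for every $N$ and every $\phi\in\Phi_N$: 1. $\phi\mapsto p_\phi(x)$ is differentiable for every $x$, $\psi$ is differentiable, and $I(\phi)$ is invertible; 2. under $p_\phi$ the normalized score $\tilde x$ is sub-Gaussian with parameter $C_1$: $\mathbb E\exp(\langle v,\tilde x\rangle^2/C_1^2)\le2$ for all unit vectors $v\in\mathbb R^p$; 3. $\|\nabla_\phi\psi(\phi)\|_F<C_2$, and $\|s_\phi(x)/D\|_2<C_3$ for all $x\in\mathbb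 R^D$; 4. for every number $M>C_\psi$ of draws and every $\epsilon>0$, the estimate produced at $\phi$ satisfies $\mathbb P\bigl(\|\nabla_\phi\psi(\phi)-\nabla_\phi\hat\psi_M(\phi)\|_F>\sqrt{(p\log p+\epsilon)/M}\bigr)<e^{-\epsilon}$ and $\mathbb P\bigl(\|\nabla_\phi\hat\psi_M(\phi)\|_F>C_2\bigr)<e^{-\epsilon}$. Suppose further that $\lambda_{\max}(\Sigma_{\hat\phi}^{-1})=O_p(1)$, that $M_N$ is of order at least $Np\log p$, i.e. $Np_N\log p_N=O(M_N)$ (in particular $M_N\asymp Np_N\log p_N$ is allowed), and that $p_N$ is of order at least $\log N$, i.e. $\log N=O(p_N)$. **Conclusion.** For every $N\ge1$ each of the two algorithms returns exactly one point; call these points $\hat\theta^{\rm MC}_N$ and $\hat\theta^{\rm an}_N$. As $N\to\infty$, $$\|\hat\theta^{\rm MC}_N-\hat\theta^{\rm an}_N\|=O_p(N^{-1/2}),$$ and the MC-EIF estimator converges to $\theta^*$ at the same rate as the analytic one: for every sequence $r_N>0$ with $N^{-1/2}=O(r_N)$, $$\|\hat\theta^{\rm an}_N-\theta^*_N\|=O_p(r_N)\iff\|\hat\theta^{\rm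 MC}_N-\theta^*_N\|=O_p(r_N).$$ -/

import Mathlib

open MeasureTheory ProbabilityTheory Filter Asymptotics

open scoped Matrix

/-- Euclidean space of dimension `n`. -/
abbrev Vec (n : ℕ) : Type := EuclideanSpace ℝ (Fin n)

/-- A dominated parametric statistical model on `ℝ^D` with an open parameter set in `ℝ^p`.
The `σ`-finite dominating measure `base` is arbitrary, so that discrete and mixed observables
are covered.  Values of `density φ` for `φ` outside `paramSet` play no role. -/
structure ParametricModel (p D : ℕ) where
  paramSet : Set (Vec p)
  isOpen_paramSet : IsOpen paramSet
  base : Measure (Vec D)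
  sigmaFinite_base : SigmaFinite base
  density : Vec p → Vec D → ℝ
  measurable_density : Measurable (Function.uncurry density)
  density_nonneg : ∀ φ ∈ paramSet, ∀ x, 0 ≤ density φ x
  lintegral_density : ∀ φ ∈ paramSet, ∫⁻ x, ENNReal.ofReal (density φ x) ∂base = 1

namespace ParametricModel

variable {p D : ℕ} (𝓜 : ParametricModel p D)

/-- The distribution with density `p_φ`. -/
noncomputable def law (φ : Vec p) : Measure (Vec D) :=
  𝓜.base.withDensity fun x => ENNReal.ofReal (𝓜.density φ x)

/-- The score `∇_φ log p_φ(x)`.  (At a parameter where the nonnegative differentiable function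
`φ ↦ p_φ(x)` vanishes this is `0`, the usual convention.) -/
noncomputable def score (φ : Vec p) (x : Vec D) : Vec p :=
  gradient (fun φ' => Real.log (𝓜.density φ' x)) φ

/-- The Fisher information `I(φ) = E_{x ∼ p_φ} [∇ log p_φ(x) ∇ log p_φ(x)ᵀ]`. -/
noncomputable def fisher (φ : Vec p) : Matrix (Fin p) (Fin p) ℝ :=
  Matrix.of fun i j => ∫ x, 𝓜.score φ x i * 𝓜.score φ x j ∂𝓜.law φ

/-- The second moment matrix `Σ = I(φ) / D` of the normalized score `D^{-1/2} ∇ log p_φ(x)`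
(its covariance matrix, the score being centred in a regular model). -/
noncomputable def normalizedFisher (φ : Vec p) : Matrix (Fin p) (Fin p) ℝ :=
  (D : ℝ)⁻¹ • 𝓜.fisher φ

/-- The Monte Carlo Fisher information `(1/M) ∑_m ∇ log p_φ(y_m) ∇ log p_φ(y_m)ᵀ`. -/
noncomputable def empiricalFisher {M : ℕ} (φ : Vec p) (y : Fin M → Vec D) :
    Matrix (Fin p) (Fin p) ℝ :=
  (M : ℝ)⁻¹ • ∑ k, Matrix.vecMulVec (𝓜.score φ (y k)).ofLp (𝓜.score φ (y k)).ofLp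

/-- `φ ↦ p_φ(x)` is differentiable (hence continuous) on the parameter set, for every `x`. -/
def DifferentiableDensity : Prop :=
  ∀ φ ∈ 𝓜.paramSet, ∀ x, DifferentiableAt ℝ (fun φ' => 𝓜.density φ' x) φ

/-- The Fisher information is invertible. -/
def FisherInvertible : Prop :=
  ∀ φ ∈ 𝓜.paramSet, IsUnit (𝓜.fisher φ)

/-- Under `p_φ`, the normalized score `x̃ = D^{-1/2} ∇ log p_φ(x)` is a sub-Gaussian vector with
parameter `C₁`: every one-dimensional marginal `⟨v, x̃⟩`, `‖v‖ = 1`, has Orlicz `ψ₂`-norm at most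
`C₁`, that is, `E exp(⟨v, x̃⟩² / C₁²) ≤ 2`. -/
def SubGaussianScore (C₁ : ℝ) : Prop :=
  ∀ φ ∈ 𝓜.paramSet, ∀ v : Vec p, ‖v‖ = 1 →
    ∫⁻ x, ENNReal.ofReal
      (Real.exp ((inner ℝ v ((Real.sqrt D)⁻¹ • 𝓜.score φ x)) ^ 2 / C₁ ^ 2)) ∂𝓜.law φ ≤ 2

/-- `‖∇ log p_φ(x) / D‖₂ < C₃` at every point `x`. -/
def BoundedScore (C₃ : ℝ) : Prop :=
  ∀ φ ∈ 𝓜.paramSet, ∀ x, ‖(D : ℝ)⁻¹ • 𝓜.score φ x‖ < C₃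

end ParametricModel

/-- Matrices carry the product `σ`-algebra. -/
instance instMeasurableSpaceRealMatrix {m n : ℕ} : MeasurableSpace (Matrix (Fin m) (Fin n) ℝ) :=
  inferInstanceAs (MeasurableSpace (Fin m → Fin n → ℝ))

/-- The Frobenius norm of a real matrix. -/
noncomputable def frobNorm {m n : ℕ} (A : Matrix (Fin m) (Fin n) ℝ) : ℝ :=
  Real.sqrt (∑ i, ∑ j, A i j ^ 2)

/-- The largest eigenvalue of a (symmetric) real matrix. -/
noncomputable def lambdaMax {n : ℕ} (A : Matrix (Fin n) (Fin n) ℝ) : ℝ :=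
  sSup (spectrum ℝ A)

/-- The `L × p` Jacobian matrix `[∇_φ ψ(φ)]ᵀ`. -/
noncomputable def jacobian {p L : ℕ} (ψ : Vec p → Vec L) (φ : Vec p) :
    Matrix (Fin L) (Fin p) ℝ :=
  Matrix.of fun i j => fderiv ℝ ψ φ (EuclideanSpace.single j 1) i

/-- The vector `A F⁻¹ s`: for `A = [∇ψ(φ)]ᵀ`, `F = I(φ)` and `s = ∇ log p_φ(x)` this is the
efficient influence function at `x`. -/
noncomputable def influence {p L : ℕ} (A : Matrix (Fin L) (Fin p) ℝ)
    (F : Matrix (Fin p) (Fin p) ℝ) (s : Vec p) : Vec L :=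
  WithLp.toLp 2 (A *ᵥ (F⁻¹ *ᵥ s.ofLp))

section Functionals

variable {p D J L : ℕ} (𝓜 : ParametricModel p D)

/-- `ψ(φ) = E_{x ∼ p_φ}[m(x, η(p_φ))]`. -/
noncomputable def targetFunctional (η : Measure (Vec D) → Vec J) (m : Vec D → Vec J → Vec L)
    (φ : Vec p) : Vec L :=
  ∫ x, m x (η (𝓜.law φ)) ∂𝓜.law φ

/-- `μ_θ(φ) = E_{x ∼ p_φ}[g(x, η(p_φ), θ)]`. -/
noncomputable def momentFunctional (η : Measure (Vec D) → Vec J)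
    (g : Vec D → Vec J → Vec L → Vec L) (θ : Vec L) (φ : Vec p) : Vec L :=
  ∫ x, g x (η (𝓜.law φ)) θ ∂𝓜.law φ

/-- The efficient influence function `φ_φ(x, θ) = [∇_φ μ_θ(φ)]ᵀ I(φ)⁻¹ ∇ log p_φ(x)` of `μ_θ`. -/
noncomputable def analyticEIF (η : Measure (Vec D) → Vec J)
    (g : Vec D → Vec J → Vec L → Vec L) (φ : Vec p) (x : Vec D) (θ : Vec L) : Vec L :=
  influence (jacobian (momentFunctional 𝓜 η g θ) φ) (𝓜.fisher φ) (𝓜.score φ x)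

/-- The Monte Carlo efficient influence function at `(x, θ)`, from the Monte Carlo sample `y` and
an estimate `G θ` of the Jacobian `[∇_φ μ_θ(φ)]ᵀ`. -/
noncomputable def mcEIF {M : ℕ} (y : Fin M → Vec D) (G : Vec L → Matrix (Fin L) (Fin p) ℝ)
    (φ : Vec p) (x : Vec D) (θ : Vec L) : Vec L :=
  influence (G θ) (𝓜.empiricalFisher φ y) (𝓜.score φ x)

/-- `f(θ) = (2/N) ∑_{n = N/2+1}^{N} [g(x_n, η(p_φ), θ) + ξ(x_n, θ)]`, the empirical orthogonal
moment over the held-out half of the data, for an influence function `ξ`.  (Indices in `Fin N`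
start at `0`.) -/
noncomputable def orthogonalMoment (η : Measure (Vec D) → Vec J)
    (g : Vec D → Vec J → Vec L → Vec L) (ξ : Vec D → Vec L → Vec L) {N : ℕ}
    (x : Fin N → Vec D) (φ : Vec p) (θ : Vec L) : Vec L :=
  ((2 : ℝ) / N) • ∑ n with N / 2 ≤ n.val, (g (x n) (η (𝓜.law φ)) θ + ξ (x n) θ)

/-- The output `{θ : f(θ) = 0}` of analytic debiased/double ML with initial estimate `φ`. -/
noncomputable def analyticDML (η : Measure (Vec D) → Vec J)
    (g : Vec D → Vec J → Vec L → Vec L) {N : ℕ} (x : Fin N → Vec D) (φ : Vec p) : Set (Vec L) :=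
  {θ | orthogonalMoment 𝓜 η g (analyticEIF 𝓜 η g φ) x φ θ = 0}

/-- The output `{θ : f(θ) = 0}` of debiased/double ML with the Monte Carlo influence function. -/
noncomputable def mcDML (η : Measure (Vec D) → Vec J)
    (g : Vec D → Vec J → Vec L → Vec L) {N M : ℕ} (x : Fin N → Vec D) (φ : Vec p)
    (y : Fin M → Vec D) (G : Vec L → Matrix (Fin L) (Fin p) ℝ) : Set (Vec L) :=
  {θ | orthogonalMoment 𝓜 η g (mcEIF 𝓜 y G φ) x φ θ = 0}

/-- A Monte Carlo procedure with `M` draws: given a parameter `φ`, it produces a random sample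
`y_1, …, y_M` and a random matrix `G`.  It is a valid simulator for the model when the sample is
i.i.d. from `p_φ`; the dependence between the sample and `G` is not restricted. -/
def IsSimulator {M : ℕ}
    (mc : Kernel (Vec p) ((Fin M → Vec D) × Matrix (Fin L) (Fin p) ℝ)) : Prop :=
  ∀ φ ∈ 𝓜.paramSet, (mc φ).map Prod.fst = Measure.pi fun _ : Fin M => 𝓜.law φ

/-- Accuracy of the random matrix `G` produced with `M` draws, as an estimate of `[∇ψ(φ)]ᵀ`. -/
def GradientAccuracy (ψ : Vec p → Vec L) (C₂ : ℝ) {M : ℕ}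
    (mc : Kernel (Vec p) ((Fin M → Vec D) × Matrix (Fin L) (Fin p) ℝ)) : Prop :=
  ∀ φ ∈ 𝓜.paramSet, ∀ ε : ℝ, 0 < ε →
    mc φ {u | Real.sqrt ((p * Real.log p + ε) / M) < frobNorm (jacobian ψ φ - u.2)}
        < ENNReal.ofReal (Real.exp (-ε)) ∧
    mc φ {u | C₂ < frobNorm u.2} < ENNReal.ofReal (Real.exp (-ε))

end Functionals

/-- The first half `x_1, …, x_{N/2}` of the data. -/
def firstHalf {D N : ℕ} (x : Fin N → Vec D) : Fin (N / 2) → Vec D :=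
  fun i => x ⟨i.val, lt_of_lt_of_le i.isLt (Nat.div_le_self N 2)⟩

theorem measurable_firstHalf {D N : ℕ} : Measurable (firstHalf : (Fin N → Vec D) → _) :=
  measurable_pi_lambda _ fun _ => measurable_pi_apply _

/-- What is drawn when the algorithm is run: `((x, φ̂), (y, G))`, with the data `x`, the initial
estimate `φ̂`, and the output `(y, G)` of the Monte Carlo procedure. -/
abbrev Outcome (p D L N M : ℕ) : Type :=
  ((Fin N → Vec D) × Vec p) × ((Fin M → Vec D) × Matrix (Fin L) (Fin p) ℝ)

/-- The joint distribution of an outcome: the data are i.i.d. from `P`; the initial estimate is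
computed (possibly with additional randomness) from the first half of the data; given the data and
the initial estimate `φ̂`, the Monte Carlo procedure is run at `φ̂`. -/
noncomputable def outcomeLaw {p D L N M : ℕ} (P : Measure (Vec D))
    (init : Kernel (Fin (N / 2) → Vec D) (Vec p))
    (mc : Kernel (Vec p) ((Fin M → Vec D) × Matrix (Fin L) (Fin p) ℝ)) :
    Measure (Outcome p D L N M) :=
  ((Measure.pi fun _ : Fin N => P) ⊗ₘ (init.comap firstHalf measurable_firstHalf)) ⊗ₘ
    (mc.comap Prod.snd measurable_snd)

/-- `Z_N = O_p(r_N)`, where `Z_N` lives on the probability space `(Ω_N, P_N)`. -/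
def IsBigOP {Ω : ℕ → Type*} [∀ N, MeasurableSpace (Ω N)] (P : ∀ N, Measure (Ω N))
    (Z : ∀ N, Ω N → ℝ) (r : ℕ → ℝ) : Prop :=
  ∀ ε : ℝ, 0 < ε → ∃ K : ℝ, ∀ᶠ N in atTop,
    P N {ω | K * r N < |Z N ω|} ≤ ENNReal.ofReal ε

/-! For linear estimating equations each algorithm returns the held-out average of `m` plus its
influence term. The `m` parts cancel, so the gap is the average of `(Ĝ Î⁻¹ − G I⁻¹) s(x_n)`.
Replacing both information matrices and the score by their quotients by `D` changes nothing and
makes the score factor at most `C₃` at every point. The gap is therefore at most `C₃` times a single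
operator norm, whatever the dependence between draws, matrix and data
(`norm_mcDML_sub_analyticDML_le`). Perturbation of inverses (`norm_mul_inv_sub_mul_inv_le`) bounds
that norm by the Jacobian error `a` and the normalized Fisher error `t`, once `λ_max(Σ⁻¹) ≤ K` and
`K t ≤ 1/2`.

The error `a` is of order `√(p log p / M)` by assumption. The error `t` is of order `√(p / M)`
outside an event of probability `2 exp(-p)` (`measure_norm_empiricalSecondMoment_sub_gt_le`). Since
`M` is at least of order `N p log p`, both are `O(N^{-1/2})`; since `p → ∞`, the exceptional
probability vanishes. Equality of rates is then the triangle inequality.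

The concentration bound integrates over the unit ball where one would usually take a union bound
over a net: the exponential of the quadratic form has a controlled mean by a Bernstein-type
estimate, while a symmetric matrix of large norm has a large quadratic form on a whole ball of
radius `1/8`. Markov's inequality compares the two.

All bounds hold conditionally on the initial estimate. Passing to the joint law
(`outcomeLaw_preimage_le`) needs events that are measurable jointly in the parameter and the Monte
Carlo output, hence the joint measurability of the score. -/

/-! ### Operator norms: perturbation of inverses and quadratic forms. -/

section OperatorNorm

open scoped Matrix.Norms.L2Operator

theorem norm_toLp_mulVec_le {m n : ℕ} (A : Matrix (Fin m) (Fin n) ℝ) (x : Fin n → ℝ) :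
    ‖(WithLp.toLp 2 (A *ᵥ x) : Vec m)‖ ≤ ‖A‖ * ‖(WithLp.toLp 2 x : Vec n)‖ :=
  A.l2_opNorm_mulVec (WithLp.toLp 2 x)

theorem l2_opNorm_le_frobNorm {m n : ℕ} (A : Matrix (Fin m) (Fin n) ℝ) : ‖A‖ ≤ frobNorm A := by
  rw [Matrix.l2_opNorm_def]
  refine ContinuousLinearMap.opNorm_le_bound _ (Real.sqrt_nonneg _) fun x => ?_
  have h0 : 0 ≤ ∑ i, ∑ j, A i j ^ 2 :=
    Finset.sum_nonneg fun i _ => Finset.sum_nonneg fun j _ => sq_nonneg (A i j)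
  rw [EuclideanSpace.norm_eq, EuclideanSpace.norm_eq, frobNorm]
  refine le_trans (Real.sqrt_le_sqrt ?_) (Real.sqrt_mul h0 _).le
  rw [Finset.sum_mul]
  refine Finset.sum_le_sum fun i _ => ?_
  simp only [Real.norm_eq_abs, sq_abs]
  exact Finset.sum_mul_sq_le_sq_mul_sq Finset.univ (fun j => A i j) x.ofLp

/-- Diagonalize by a unitary, which preserves the operator norm. Semidefiniteness makes each `|λ|`
equal to `λ`, and the spectrum is finite, so its `sSup` really bounds every eigenvalue. -/
theorem norm_le_of_lambdaMax_le {n : ℕ} {A : Matrix (Fin n) (Fin n) ℝ} (hA : A.PosSemidef)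
    {K : ℝ} (hK : 0 ≤ K) (h : lambdaMax A ≤ K) : ‖A‖ ≤ K := by
  have key : ‖(Matrix.diagonal (RCLike.ofReal ∘ hA.1.eigenvalues) : Matrix (Fin n) (Fin n) ℝ)‖
      ≤ K := by
    rw [Matrix.l2_opNorm_diagonal]
    refine (pi_norm_le_iff_of_nonneg hK).2 fun i => ?_
    simp only [Function.comp_apply, RCLike.ofReal_real_eq_id, id_eq, Real.norm_eq_abs]
    rw [abs_of_nonneg (hA.eigenvalues_nonneg i)]
    exact (le_csSup A.finite_real_spectrum.bddAbove (hA.1.eigenvalues_mem_spectrum_real i)).trans h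
  rw [hA.1.spectral_theorem, Unitary.conjStarAlgAut_apply]
  rw [CStarRing.norm_mul_mem_unitary _ (by simp), CStarRing.norm_mem_unitary_mul _ (by simp)]
  exact key

/-- Neumann series: `T = S (1 + S⁻¹ (T - S))` with a perturbation of norm at most `1/2`. In the
resolvent identity for `T⁻¹` the error term is then at most `‖T⁻¹‖ / 2` and is absorbed on the left.
-/
theorem norm_inv_le_of_norm_sub_le {n : ℕ} {S T : Matrix (Fin n) (Fin n) ℝ} (hS : IsUnit S)
    {K t : ℝ} (hK : ‖S⁻¹‖ ≤ K) (ht : ‖T - S‖ ≤ t) (hKt : K * t ≤ 1 / 2) :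
    IsUnit T ∧ ‖T⁻¹‖ ≤ 2 * K := by
  have hK0 : 0 ≤ K := (norm_nonneg _).trans hK
  have hSd : IsUnit S.det := (Matrix.isUnit_iff_isUnit_det _).1 hS
  have hb : ‖S⁻¹ * (T - S)‖ ≤ 1 / 2 :=
    (norm_mul_le _ _).trans ((mul_le_mul hK ht (norm_nonneg _) hK0).trans hKt)
  have hT : IsUnit T := by
    have h1 : IsUnit (1 - -(S⁻¹ * (T - S))) := by
      have : CompleteSpace (Matrix (Fin n) (Fin n) ℝ) := FiniteDimensional.complete ℝ _
      exact isUnit_one_sub_of_norm_lt_one (by rw [norm_neg]; linarith)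
    have h2 : T = S * (1 - -(S⁻¹ * (T - S))) := by
      rw [sub_neg_eq_add, mul_add, ← mul_assoc, Matrix.mul_nonsing_inv _ hSd]
      simp
    rw [h2]
    exact hS.mul h1
  refine ⟨hT, ?_⟩
  have hTd : IsUnit T.det := (Matrix.isUnit_iff_isUnit_det _).1 hT
  have h3 : T⁻¹ = S⁻¹ - S⁻¹ * (T - S) * T⁻¹ := by
    rw [mul_sub, sub_mul, mul_assoc, Matrix.mul_nonsing_inv _ hTd, Matrix.nonsing_inv_mul _ hSd]
    simp
  have h4 : ‖T⁻¹‖ ≤ ‖S⁻¹‖ + ‖S⁻¹ * (T - S)‖ * ‖T⁻¹‖ := by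
    conv_lhs => rw [h3]
    exact (norm_sub_le _ _).trans (by gcongr; exact norm_mul_le _ _)
  nlinarith [norm_nonneg T⁻¹, mul_le_mul_of_nonneg_right hb (norm_nonneg T⁻¹)]

theorem norm_mul_inv_sub_mul_inv_le {l n : ℕ} {A B : Matrix (Fin l) (Fin n) ℝ}
    {S T : Matrix (Fin n) (Fin n) ℝ} (hS : IsUnit S) {K t a C : ℝ} (hK : ‖S⁻¹‖ ≤ K)
    (ht : ‖T - S‖ ≤ t) (hKt : K * t ≤ 1 / 2) (hA : ‖A‖ ≤ C) (hB : ‖A - B‖ ≤ a) :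
    ‖B * T⁻¹ - A * S⁻¹‖ ≤ 2 * K * a + 2 * C * K ^ 2 * t := by
  obtain ⟨hT, hT'⟩ := norm_inv_le_of_norm_sub_le hS hK ht hKt
  have hK0 : 0 ≤ K := (norm_nonneg _).trans hK
  have ht0 : 0 ≤ t := (norm_nonneg _).trans ht
  have hC0 : 0 ≤ C := (norm_nonneg _).trans hA
  have ha0 : 0 ≤ a := (norm_nonneg _).trans hB
  have hSd : IsUnit S.det := (Matrix.isUnit_iff_isUnit_det _).1 hS
  have hTd : IsUnit T.det := (Matrix.isUnit_iff_isUnit_det _).1 hT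
  -- Split so that the size bound `C` falls on `A`, the exact Jacobian in the application, while `B`
  -- occurs only in the difference `A - B`.
  have h3 : B * T⁻¹ - A * S⁻¹ = -((A - B) * T⁻¹) - A * (S⁻¹ * ((T - S) * T⁻¹)) := by
    have : S⁻¹ * ((T - S) * T⁻¹) = S⁻¹ - T⁻¹ := by
      rw [sub_mul, mul_sub, ← mul_assoc S⁻¹ S, Matrix.mul_nonsing_inv _ hTd,
        Matrix.nonsing_inv_mul _ hSd]
      simp
    rw [this, Matrix.sub_mul, Matrix.mul_sub]
    abel
  rw [h3]
  calc _ ≤ ‖(A - B) * T⁻¹‖ + ‖A * (S⁻¹ * ((T - S) * T⁻¹))‖ := by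
        simpa using norm_sub_le (-((A - B) * T⁻¹)) (A * (S⁻¹ * ((T - S) * T⁻¹)))
    _ ≤ a * (2 * K) + C * (K * (t * (2 * K))) := by
        refine add_le_add ((Matrix.l2_opNorm_mul _ _).trans (by gcongr)) ?_
        refine (Matrix.l2_opNorm_mul _ _).trans ?_
        gcongr
        refine (norm_mul_le _ _).trans ?_
        gcongr
        refine (norm_mul_le _ _).trans ?_
        gcongr
    _ = _ := by ring

/-- A symmetric matrix has a quadratic form bounded below, in terms of the operator norm, on some
ball of radius `1 / 8` inside the unit ball. -/
theorem exists_ball_norm_le_abs_quadratic {n : ℕ} {B : Matrix (Fin n) (Fin n) ℝ}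
    (hB : B.IsHermitian) (hB0 : B ≠ 0) :
    ∃ c : Vec n, Metric.ball c (1 / 8) ⊆ Metric.ball 0 1 ∧
      ∀ u ∈ Metric.ball c (1 / 8), ‖B‖ / 2 ≤ |u.ofLp ⬝ᵥ B *ᵥ u.ofLp| := by
  have hpos : 0 < ‖B‖ := norm_pos_iff.2 hB0
  set T := Matrix.toEuclideanCLM (n := Fin n) (𝕜 := ℝ) B with hTdef
  have hT : T.IsSymmetric := Matrix.isSymmetric_toEuclideanLin_iff.2 hB
  have hn : ‖T‖ = ‖B‖ := rfl
  -- For a symmetric operator the norm is the supremum of the absolute Rayleigh quotients; the slack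
  -- `1/64` permits a near-maximizer.
  have hlt : 63 / 64 * ‖B‖ < ⨆ x, |T.rayleighQuotient x| := by
    rw [← T.norm_eq_iSup_rayleighQuotient hT, hn]; linarith
  obtain ⟨x, hx⟩ := exists_lt_of_lt_ciSup hlt
  have hx0 : x ≠ 0 := by
    rintro rfl
    simp at hx
    linarith
  have hxn : 0 < ‖x‖ := norm_pos_iff.2 hx0
  set v : Vec n := (‖x‖⁻¹ : ℝ) • x with hv
  have hvn : ‖v‖ = 1 := by
    rw [hv, norm_smul, norm_inv, norm_norm, inv_mul_cancel₀ hxn.ne']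
  have hvq : 63 / 64 * ‖B‖ ≤ |inner ℝ v (T v)| := by
    refine hx.le.trans (le_of_eq ?_)
    rw [hv, map_smul, inner_smul_left, inner_smul_right, ContinuousLinearMap.rayleighQuotient,
      ContinuousLinearMap.reApplyInnerSelf_apply, real_inner_comm]
    congr 1
    simp
    field_simp
  clear_value v
  -- Centre at distance `7/8` from the origin, so that radius `1/8` stays in the unit ball. The
  -- final margin is `(49/64)(63/64) - (7/4)(1/8) - 1/64 > 1/2`.
  refine ⟨(7 / 8 : ℝ) • v, ?_, fun u hu => ?_⟩
  · refine Metric.ball_subset_ball' ?_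
    rw [dist_zero_right, norm_smul, hvn]
    norm_num
  · rw [← Matrix.inner_toEuclideanCLM, ← hTdef]
    set w := u - (7 / 8 : ℝ) • v with hw
    have hwn : ‖w‖ ≤ 1 / 8 := by
      rw [Metric.mem_ball, dist_eq_norm] at hu
      exact hu.le
    have hu' : u = (7 / 8 : ℝ) • v + w := by rw [hw]; abel
    have hcross : inner ℝ w (T v) = inner ℝ v (T w) := by
      rw [real_inner_comm]; exact hT v w
    have e : inner ℝ u (T u)
        = 49 / 64 * inner ℝ v (T v) + 7 / 4 * inner ℝ v (T w) + inner ℝ w (T w) := by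
      rw [hu', map_add, map_smul, inner_add_left, inner_add_right, inner_add_right,
        real_inner_smul_left, real_inner_smul_left, real_inner_smul_right, real_inner_smul_right,
        hcross]
      ring
    have b1 : |inner ℝ v (T w)| ≤ ‖B‖ * (1 / 8) := by
      refine (abs_real_inner_le_norm _ _).trans ?_
      rw [hvn, one_mul]
      exact (T.le_opNorm w).trans (by rw [hn]; gcongr)
    have b2 : |inner ℝ w (T w)| ≤ ‖B‖ * (1 / 64) := by
      refine (abs_real_inner_le_norm _ _).trans ?_
      calc ‖w‖ * ‖T w‖ ≤ (1 / 8) * (‖B‖ * (1 / 8)) := by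
            gcongr
            exact (T.le_opNorm w).trans (by rw [hn]; gcongr)
        _ = _ := by ring
    rw [e]
    rcases abs_cases (inner ℝ v (T v)) with h | h <;> rw [abs_le] at b1 b2 <;> rw [le_abs]
    · left; linarith
    · right; linarith

theorem measurable_l2_opNorm {m n : ℕ} : Measurable fun A : Matrix (Fin m) (Fin n) ℝ => ‖A‖ := by
  have h : Continuous fun A : Matrix (Fin m) (Fin n) ℝ => ‖A‖ := continuous_norm
  exact Continuous.measurable (α := Fin m → Fin n → ℝ) h

end OperatorNorm

/-! ### Concentration of empirical second moment matrices. -/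

section Concentration

/-- Second-order Taylor bound whose remainder is charged to `exp w`, the only quantity the
sub-Gaussian hypothesis controls: `w²` costs one factor `exp (w / 2)` and `exp |l w|` the other. -/
theorem exp_mul_le_of_abs_le_half {l w : ℝ} (hl : |l| ≤ 1 / 2) (hw : 0 ≤ w) :
    Real.exp (l * w) ≤ 1 + l * w + 8 * l ^ 2 * Real.exp w := by
  have h1 : |Real.exp (l * w) - (1 + l * w)| ≤ |l * w| ^ 2 * Real.exp |l * w| := by
    have := Complex.norm_exp_sub_sum_le_norm_mul_exp ((l * w : ℝ) : ℂ) 2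
    simp only [Finset.sum_range_succ, Finset.sum_range_zero, pow_zero, Nat.factorial, pow_one,
      Nat.cast_one, div_one, zero_add, Complex.norm_real, Real.norm_eq_abs, mul_one] at this
    rwa [← Complex.ofReal_exp, ← Complex.ofReal_one, ← Complex.ofReal_add, ← Complex.ofReal_sub,
      Complex.norm_real, Real.norm_eq_abs] at this
  have h2 : |l * w| ≤ w / 2 := by
    rw [abs_mul, abs_of_nonneg hw]; nlinarith
  have h3 : w ^ 2 ≤ 8 * Real.exp (w / 2) := by
    have := Real.quadratic_le_exp_of_nonneg (x := w / 2) (by positivity)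
    nlinarith
  have h4 : Real.exp |l * w| ≤ Real.exp (w / 2) := Real.exp_le_exp.2 h2
  have h5 : Real.exp (w / 2) * Real.exp (w / 2) = Real.exp w := by
    rw [← Real.exp_add]; ring_nf
  have h6 : |l * w| ^ 2 * Real.exp |l * w| ≤ 8 * l ^ 2 * Real.exp w := by
    rw [sq_abs, mul_pow, ← h5]
    calc l ^ 2 * w ^ 2 * Real.exp |l * w|
        ≤ l ^ 2 * (8 * Real.exp (w / 2)) * Real.exp (w / 2) := by gcongr
      _ = _ := by ring
  linarith [(abs_le.1 (h1.trans h6)).2]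

variable {Ω : Type*} [MeasurableSpace Ω] {μ : Measure Ω} [IsProbabilityMeasure μ]

theorem integrable_of_measurable_of_abs_le {f : Ω → ℝ} (hf : Measurable f) {b : ℝ}
    (hb : ∀ x, |f x| ≤ b) : Integrable f μ :=
  Integrable.of_bound hf.aestronglyMeasurable b (Eventually.of_forall hb)

/-- Bernstein-type moment bound for `W = ⟨u, X⟩² / C²`. The bound `b` only secures integrability and
does not enter the estimate, which matters because in the application it grows with `D`. -/
theorem integral_exp_mul_sub_integral_le {W : Ω → ℝ} (hW : Measurable W) (hW0 : ∀ x, 0 ≤ W x)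
    {b : ℝ} (hb : ∀ x, W x ≤ b)
    (h : ∫⁻ x, ENNReal.ofReal (Real.exp (W x)) ∂μ ≤ 2) {l : ℝ} (hl : |l| ≤ 1 / 2) :
    Integrable (fun x => Real.exp (l * (W x - ∫ x, W x ∂μ))) μ ∧
    ∫ x, Real.exp (l * (W x - ∫ x, W x ∂μ)) ∂μ ≤ Real.exp (16 * l ^ 2) := by
  have iW : Integrable W μ := integrable_of_measurable_of_abs_le hW
    (fun x => by rw [abs_of_nonneg (hW0 x)]; exact hb x)
  have iE : Integrable (fun x => Real.exp (W x)) μ :=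
    integrable_of_measurable_of_abs_le hW.exp (b := Real.exp b)
    (fun x => by rw [abs_of_pos (Real.exp_pos _)]; exact Real.exp_le_exp.2 (hb x))
  have iL : Integrable (fun x => Real.exp (l * W x)) μ :=
    integrable_of_measurable_of_abs_le (hW.const_mul l).exp (b := Real.exp b)
    (fun x => by
      rw [abs_of_pos (Real.exp_pos _)]
      refine Real.exp_le_exp.2 ((?_ : _ ≤ W x).trans (hb x))
      nlinarith [(abs_le.1 hl).2, hW0 x])
  have hE : ∫ x, Real.exp (W x) ∂μ ≤ 2 := by
    rw [← ofReal_integral_eq_lintegral_ofReal iE (Eventually.of_forall fun x => (Real.exp_pos _).le)]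
      at h
    have := ENNReal.toReal_mono (by simp) h
    rwa [ENNReal.toReal_ofReal (integral_nonneg fun x => (Real.exp_pos _).le)] at this
  have e : (fun x => Real.exp (l * (W x - ∫ x, W x ∂μ)))
      = fun x => Real.exp (-(l * ∫ x, W x ∂μ)) * Real.exp (l * W x) := by
    ext x
    rw [← Real.exp_add]
    ring_nf
  rw [e]
  refine ⟨iL.const_mul _, ?_⟩
  rw [integral_const_mul]
  have hL : ∫ x, Real.exp (l * W x) ∂μ ≤ Real.exp (l * ∫ x, W x ∂μ + 16 * l ^ 2) := by
    calc ∫ x, Real.exp (l * W x) ∂μ ≤ ∫ x, (1 + l * W x + 8 * l ^ 2 * Real.exp (W x)) ∂μ :=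
          integral_mono iL (((integrable_const _).add (iW.const_mul _)).add (iE.const_mul _))
            fun x => exp_mul_le_of_abs_le_half hl (hW0 x)
      _ = 1 + l * ∫ x, W x ∂μ + 8 * l ^ 2 * ∫ x, Real.exp (W x) ∂μ := by
          rw [integral_add (f := fun x => 1 + l * W x) ((integrable_const _).add (iW.const_mul _))
            (iE.const_mul _), integral_add (integrable_const _) (iW.const_mul _),
            integral_const_mul, integral_const_mul]
          simp
      _ ≤ (l * ∫ x, W x ∂μ + 16 * l ^ 2) + 1 := by nlinarith [sq_nonneg l]
      _ ≤ _ := Real.add_one_le_exp _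
  calc _ ≤ Real.exp (-(l * ∫ x, W x ∂μ)) * Real.exp (l * ∫ x, W x ∂μ + 16 * l ^ 2) := by gcongr
    _ = _ := by rw [← Real.exp_add]; ring_nf

theorem lintegral_exp_mul_sum_le {W : Ω → ℝ} (hW : Measurable W) (hW0 : ∀ x, 0 ≤ W x)
    {b : ℝ} (hb : ∀ x, W x ≤ b)
    (h : ∫⁻ x, ENNReal.ofReal (Real.exp (W x)) ∂μ ≤ 2) {l : ℝ} (hl : |l| ≤ 1 / 2) (M : ℕ) :
    ∫⁻ y, ENNReal.ofReal (Real.exp (l * ∑ k, (W (y k) - ∫ x, W x ∂μ)))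
      ∂(Measure.pi fun _ : Fin M => μ) ≤ ENNReal.ofReal (Real.exp (16 * l ^ 2 * M)) := by
  obtain ⟨hi, hle⟩ := integral_exp_mul_sub_integral_le hW hW0 hb h hl
  have e : ∀ y : Fin M → Ω, Real.exp (l * ∑ k, (W (y k) - ∫ x, W x ∂μ))
      = ∏ k, Real.exp (l * (W (y k) - ∫ x, W x ∂μ)) := fun y => by
    rw [Finset.mul_sum, Real.exp_sum]
  simp only [e]
  rw [← ofReal_integral_eq_lintegral_ofReal
    (Integrable.fintype_prod (f := fun _ x => Real.exp (l * (W x - ∫ x, W x ∂μ))) fun _ => hi)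
    (Eventually.of_forall fun y => Finset.prod_nonneg fun _ _ => (Real.exp_pos _).le)]
  refine ENNReal.ofReal_le_ofReal ?_
  rw [integral_fintype_prod_eq_pow (fun x => Real.exp (l * (W x - ∫ x, W x ∂μ))), Fintype.card_fin]
  refine (pow_le_pow_left₀ (integral_nonneg fun x => (Real.exp_pos _).le) hle M).trans ?_
  rw [← Real.exp_nat_mul]
  exact le_of_eq (by ring_nf)

/-- The matrix of second moments of a random vector. -/
noncomputable def secondMoment {p : ℕ} (μ : Measure Ω) (X : Ω → Vec p) :
    Matrix (Fin p) (Fin p) ℝ :=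
  Matrix.of fun i j => ∫ x, X x i * X x j ∂μ

/-- The matrix of empirical second moments of a random vector. -/
noncomputable def empiricalSecondMoment {p M : ℕ} (X : Ω → Vec p) (y : Fin M → Ω) :
    Matrix (Fin p) (Fin p) ℝ :=
  (M : ℝ)⁻¹ • ∑ k, Matrix.vecMulVec (X (y k)).ofLp (X (y k)).ofLp

theorem isHermitian_secondMoment {p : ℕ} (μ : Measure Ω) (X : Ω → Vec p) :
    (secondMoment μ X).IsHermitian := by
  ext i j
  simp [secondMoment, mul_comm]

theorem isHermitian_empiricalSecondMoment {Ω : Type*} {p M : ℕ} (X : Ω → Vec p) (y : Fin M → Ω) :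
    (empiricalSecondMoment X y).IsHermitian := by
  ext i j
  simp [empiricalSecondMoment, Matrix.sum_apply, Matrix.vecMulVec_apply, mul_comm]

theorem dotProduct_secondMoment_mulVec {p : ℕ} {X : Ω → Vec p} (hX : Measurable X) {b : ℝ}
    (hb : ∀ x, ‖X x‖ ≤ b) (u : Vec p) :
    u.ofLp ⬝ᵥ secondMoment μ X *ᵥ u.ofLp = ∫ x, inner ℝ u (X x) ^ 2 ∂μ := by
  have hm : ∀ i, Measurable fun x => X x i := fun i =>
    (EuclideanSpace.proj (𝕜 := ℝ) i).continuous.measurable.comp hX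
  have hi : ∀ i j, Integrable (fun x => X x i * X x j) μ := fun i j =>
    integrable_of_measurable_of_abs_le ((hm i).mul (hm j)) (b := b * b) fun x => by
      rw [abs_mul]
      have h := fun i => (PiLp.norm_apply_le (X x) i).trans (hb x)
      exact mul_le_mul (h i) (h j) (abs_nonneg _) ((norm_nonneg _).trans (hb x))
  have e : ∀ x, inner ℝ u (X x) ^ 2 = ∑ i, ∑ j, (u i * u j) * (X x i * X x j) := fun x => by
    simp only [PiLp.inner_apply, RCLike.inner_apply, conj_trivial, sq, Finset.sum_mul_sum]
    exact Finset.sum_congr rfl fun i _ => Finset.sum_congr rfl fun j _ => by ring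
  simp only [e]
  rw [integral_finsetSum _ fun i _ => integrable_finsetSum _ fun j _ => (hi i j).const_mul _]
  simp only [dotProduct, Matrix.mulVec, Finset.mul_sum]
  refine Finset.sum_congr rfl fun i _ => ?_
  rw [integral_finsetSum _ fun j _ => (hi i j).const_mul _]
  refine Finset.sum_congr rfl fun j _ => ?_
  rw [integral_const_mul, secondMoment, Matrix.of_apply]
  ring

theorem dotProduct_empiricalSecondMoment_mulVec {Ω : Type*} {p M : ℕ} (X : Ω → Vec p)
    (y : Fin M → Ω) (u : Vec p) :
    u.ofLp ⬝ᵥ empiricalSecondMoment X y *ᵥ u.ofLp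
      = (M : ℝ)⁻¹ * ∑ k, inner ℝ u (X (y k)) ^ 2 := by
  rw [empiricalSecondMoment, Matrix.smul_mulVec, dotProduct_smul, smul_eq_mul, Matrix.sum_mulVec,
    dotProduct_sum]
  congr 1
  refine Finset.sum_congr rfl fun k _ => ?_
  rw [Matrix.vecMulVec_mulVec]
  simp only [dotProduct, PiLp.inner_apply, RCLike.inner_apply, conj_trivial, sq, Pi.smul_apply,
    MulOpposite.smul_eq_mul_unop, MulOpposite.unop_op, Finset.sum_mul_sum]
  refine Finset.sum_congr rfl fun i _ => ?_
  simp only [Finset.mul_sum]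
  exact Finset.sum_congr rfl fun j _ => by ring

/-- Shrinking a unit vector only decreases the exponent. The extension to the whole ball is needed
because the concentration argument integrates over it. -/
theorem lintegral_exp_inner_sq_le {p : ℕ} {X : Ω → Vec p} {C : ℝ}
    (h : ∀ v : Vec p, ‖v‖ = 1 →
      ∫⁻ x, ENNReal.ofReal (Real.exp (inner ℝ v (X x) ^ 2 / C ^ 2)) ∂μ ≤ 2)
    {u : Vec p} (hu : ‖u‖ ≤ 1) :
    ∫⁻ x, ENNReal.ofReal (Real.exp (inner ℝ u (X x) ^ 2 / C ^ 2)) ∂μ ≤ 2 := by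
  rcases eq_or_ne u 0 with rfl | hu0
  · simp
  have hn : 0 < ‖u‖ := norm_pos_iff.2 hu0
  refine le_trans (lintegral_mono fun x => ENNReal.ofReal_le_ofReal (Real.exp_le_exp.2 ?_))
    (h ((‖u‖⁻¹ : ℝ) • u) (by rw [norm_smul, norm_inv, norm_norm, inv_mul_cancel₀ hn.ne']))
  refine div_le_div_of_nonneg_right ?_ (sq_nonneg C)
  rw [real_inner_smul_left, mul_pow]
  have : 1 ≤ ‖u‖⁻¹ ^ 2 := one_le_pow₀ ((one_le_inv₀ hn).2 hu)
  nlinarith [sq_nonneg (inner ℝ u (X x))]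

open scoped Matrix.Norms.L2Operator in
/-- Concentration of the empirical second moment matrix of a bounded sub-Gaussian vector. -/
theorem measure_norm_empiricalSecondMoment_sub_gt_le {p M : ℕ} (hM : 4 * p ≤ M) (hp : 0 < p)
    {X : Ω → Vec p} (hX : Measurable X)
    {b : ℝ} (hb : ∀ x, ‖X x‖ ≤ b) {C : ℝ} (hC : 0 < C)
    (h : ∀ v : Vec p, ‖v‖ = 1 →
      ∫⁻ x, ENNReal.ofReal (Real.exp (inner ℝ v (X x) ^ 2 / C ^ 2)) ∂μ ≤ 2) :
    (Measure.pi fun _ : Fin M => μ)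
      {y | 40 * C ^ 2 * Real.sqrt (p / M) < ‖empiricalSecondMoment X y - secondMoment μ X‖}
      ≤ ENNReal.ofReal (2 * Real.exp (-p)) := by
  have hpR : (0 : ℝ) < p := by exact_mod_cast hp
  have hMR : (0 : ℝ) < M := by
    have : 0 < M := by omega
    exact_mod_cast this
  have hM4 : (4 : ℝ) * p ≤ M := by exact_mod_cast hM
  -- Chosen so that `l² M = p`, which turns the moment bound `exp (16 l² M)` into `exp (16 p)`; `4 p
  -- ≤ M` gives `l ≤ 1/2`.
  set l := Real.sqrt (p / M) with hl
  have hl0 : 0 < l := Real.sqrt_pos.2 (by positivity)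
  have hl2 : l ^ 2 = p / M := Real.sq_sqrt (by positivity)
  have hlM : l ^ 2 * M = p := by rw [hl2]; field_simp
  have hlh : |l| ≤ 1 / 2 := by
    rw [abs_of_pos hl0, hl]
    refine Real.sqrt_le_iff.2 ⟨by norm_num, ?_⟩
    rw [div_le_iff₀ hMR]; linarith
  let W : Vec p → Ω → ℝ := fun u x => inner ℝ u (X x) ^ 2 / C ^ 2
  let Q : (Fin M → Ω) → Vec p → ℝ := fun y u => ∑ k, (W u (y k) - ∫ x, W u x ∂μ)
  have hWm : ∀ u, Measurable (W u) := fun u =>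
    (((continuous_const.inner continuous_id).measurable.comp hX).pow_const 2).div_const _
  have hQm : Measurable (Function.uncurry Q) := by
    have hW2 : Measurable (Function.uncurry W) := by
      refine (Measurable.pow_const ?_ 2).div_const _
      exact Measurable.inner measurable_fst (hX.comp measurable_snd)
    have hI : Measurable fun u => ∫ x, W u x ∂μ :=
      (StronglyMeasurable.integral_prod_right hW2.stronglyMeasurable).measurable
    refine Finset.measurable_sum _ fun k _ => ?_
    exact (hW2.comp (measurable_snd.prodMk ((measurable_pi_apply k).comp measurable_fst))).sub
      (hI.comp measurable_snd)
  let F : (Fin M → Ω) → ENNReal := fun y =>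
    ∫⁻ u in Metric.ball (0 : Vec p) 1, ENNReal.ofReal (Real.exp (l * |Q y u|))
  have hGm : Measurable (Function.uncurry fun (y : Fin M → Ω) (u : Vec p) =>
      ENNReal.ofReal (Real.exp (l * |Q y u|))) :=
    ((hQm.abs.const_mul l).exp).ennreal_ofReal
  have hFm : Measurable F := hGm.lintegral_prod_right'
  set V := volume (Metric.ball (0 : Vec p) 1) with hV
  have hV0 : V ≠ 0 := (Metric.measure_ball_pos _ _ one_pos).ne'
  have hVt : V ≠ ⊤ := measure_ball_lt_top.ne
  -- upper bound for the mean of `F`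
  have hup : ∫⁻ y, F y ∂(Measure.pi fun _ : Fin M => μ)
      ≤ ENNReal.ofReal (2 * Real.exp (16 * p)) * V := by
    rw [lintegral_lintegral_swap hGm.aemeasurable]
    rw [← setLIntegral_const]
    refine setLIntegral_mono measurable_const fun u hu => ?_
    have hun : ‖u‖ ≤ 1 := by
      rw [mem_ball_zero_iff] at hu
      exact hu.le
    have hWb : ∀ x, W u x ≤ b ^ 2 / C ^ 2 := fun x => by
      refine div_le_div_of_nonneg_right ?_ (sq_nonneg C)
      rw [← sq_abs]
      refine pow_le_pow_left₀ (abs_nonneg _) ((abs_real_inner_le_norm _ _).trans ?_) 2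
      calc ‖u‖ * ‖X x‖ ≤ 1 * b := mul_le_mul hun (hb x) (norm_nonneg _) zero_le_one
        _ = b := one_mul b
    have key := fun l' hl' => lintegral_exp_mul_sum_le (μ := μ) (l := l') (hWm u)
      (fun x => by positivity) hWb (lintegral_exp_inner_sq_le h hun) hl' M
    calc ∫⁻ y, ENNReal.ofReal (Real.exp (l * |Q y u|)) ∂(Measure.pi fun _ : Fin M => μ)
        ≤ ∫⁻ y, (ENNReal.ofReal (Real.exp (l * Q y u)) + ENNReal.ofReal (Real.exp (-l * Q y u)))
          ∂(Measure.pi fun _ : Fin M => μ) := by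
          refine lintegral_mono fun y => ?_
          rcases abs_cases (Q y u) with h | h <;> rw [h.1]
          · exact le_self_add
          · rw [mul_neg, ← neg_mul]
            exact le_add_self
      _ ≤ ENNReal.ofReal (Real.exp (16 * l ^ 2 * M))
          + ENNReal.ofReal (Real.exp (16 * (-l) ^ 2 * M)) := by
          rw [lintegral_add_left]
          · exact add_le_add (key l hlh) (key (-l) (by rwa [abs_neg]))
          · exact (((hQm.comp measurable_prodMk_right).const_mul l).exp).ennreal_ofReal
      _ = ENNReal.ofReal (2 * Real.exp (16 * p)) := by
          rw [neg_sq, mul_assoc, hlM, ← ENNReal.ofReal_add (Real.exp_pos _).le (Real.exp_pos _).le]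
          ring_nf
  -- lower bound for `F` on the event
  have hlow : ∀ y, 40 * C ^ 2 * l < ‖empiricalSecondMoment X y - secondMoment μ X‖ →
      ENNReal.ofReal (Real.exp (20 * p) * (1 / 8) ^ p) * V ≤ F y := by
    intro y hy
    set B := empiricalSecondMoment X y - secondMoment μ X with hB
    have hBpos : 0 < ‖B‖ := lt_of_le_of_lt (by positivity) hy
    obtain ⟨c, hc, hcB⟩ := exists_ball_norm_le_abs_quadratic (B := B)
      ((isHermitian_empiricalSecondMoment X y).sub (isHermitian_secondMoment μ X))
      (norm_pos_iff.1 hBpos)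
    have hQB : ∀ u, Q y u = M / C ^ 2 * (u.ofLp ⬝ᵥ B *ᵥ u.ofLp) := fun u => by
      rw [hB, Matrix.sub_mulVec, dotProduct_sub, dotProduct_secondMoment_mulVec hX hb,
        dotProduct_empiricalSecondMoment_mulVec]
      simp only [Q, W, Finset.sum_sub_distrib, ← Finset.sum_div, integral_div, Finset.sum_const,
        Finset.card_univ, Fintype.card_fin, nsmul_eq_mul]
      field_simp
    calc ENNReal.ofReal (Real.exp (20 * p) * (1 / 8) ^ p) * V
        = ENNReal.ofReal (Real.exp (20 * p)) * volume (Metric.ball c (1 / 8)) := by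
          rw [Measure.addHaar_ball_of_pos _ _ (by norm_num), ENNReal.ofReal_mul (Real.exp_pos _).le,
            mul_assoc, finrank_euclideanSpace, Fintype.card_fin]
      _ = ∫⁻ u in Metric.ball c (1 / 8), ENNReal.ofReal (Real.exp (20 * p)) :=
          (setLIntegral_const _ _).symm
      _ ≤ ∫⁻ u in Metric.ball c (1 / 8), ENNReal.ofReal (Real.exp (l * |Q y u|)) := by
          refine setLIntegral_mono' Metric.isOpen_ball.measurableSet fun u hu => ?_
          refine ENNReal.ofReal_le_ofReal (Real.exp_le_exp.2 ?_)
          rw [hQB, abs_mul, abs_of_nonneg (by positivity)]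
          -- Half of the threshold `40 C² l` survives on the small ball; after multiplication by `l
          -- M / C²` it becomes `20 l² M = 20 p`.
          have h1 : 20 * C ^ 2 * l ≤ |u.ofLp ⬝ᵥ B *ᵥ u.ofLp| := by linarith [hcB u hu]
          calc (20 : ℝ) * p = l * (M / C ^ 2 * (20 * C ^ 2 * l)) := by
                rw [← hlM]; field_simp
            _ ≤ _ := by gcongr
      _ ≤ F y := lintegral_mono_set hc
  set a := ENNReal.ofReal (Real.exp (20 * p) * (1 / 8) ^ p) with ha
  have hapos : 0 < Real.exp (20 * p) * (1 / 8 : ℝ) ^ p := by positivity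
  have ha0 : a * V ≠ 0 := mul_ne_zero (by rw [ha]; exact (ENNReal.ofReal_pos.2 hapos).ne') hV0
  have hat : a * V ≠ ⊤ := ENNReal.mul_ne_top ENNReal.ofReal_ne_top hVt
  -- Markov's inequality for `F` at level `a * V`; the volume `V` of the unit ball cancels below.
  have hmk := (mul_meas_ge_le_lintegral₀ (μ := Measure.pi fun _ : Fin M => μ)
    hFm.aemeasurable (a * V)).trans hup
  have h8 : (8 : ℝ) ^ p ≤ Real.exp (3 * p) := by
    rw [mul_comm, Real.exp_nat_mul]
    refine pow_le_pow_left₀ (by norm_num) ?_ p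
    have := Real.add_one_le_exp (1 : ℝ)
    calc (8 : ℝ) = 2 ^ 3 := by norm_num
      _ ≤ Real.exp 1 ^ 3 := by gcongr; linarith
      _ = Real.exp 3 := by rw [← Real.exp_nat_mul]; norm_num
  refine (measure_mono (Set.ofPred_subset_ofPred.2 hlow)).trans ?_
  rw [← ENNReal.mul_le_mul_iff_right ha0 hat]
  refine hmk.trans ?_
  rw [mul_right_comm]
  gcongr
  rw [ha, ← ENNReal.ofReal_mul hapos.le]
  refine ENNReal.ofReal_le_ofReal ?_
  have h8' : Real.exp (-(3 * p)) ≤ (1 / 8 : ℝ) ^ p := by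
    rw [Real.exp_neg, one_div, inv_pow]
    exact inv_anti₀ (by positivity) h8
  -- Balance of exponents: `16 = 20 - 3 - 1`, where `3` pays for the volume ratio `8^p ≤ exp (3 p)`
  -- and `1` is the decay that remains.
  calc 2 * Real.exp (16 * p)
      = Real.exp (20 * p) * Real.exp (-(3 * p)) * (2 * Real.exp (-p)) := by
        rw [mul_left_comm, ← Real.exp_add, ← Real.exp_add]
        ring_nf
    _ ≤ _ := by gcongr

end Concentration

/-! ### Scores and Fisher information: measurability, and concentration in the model. -/

namespace ParametricModel

variable {p D : ℕ} {𝓜 : ParametricModel p D}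

theorem isProbabilityMeasure_law {φ : Vec p} (hφ : φ ∈ 𝓜.paramSet) :
    IsProbabilityMeasure (𝓜.law φ) :=
  ⟨by rw [law, withDensity_apply _ MeasurableSet.univ, Measure.restrict_univ,
    𝓜.lintegral_density φ hφ]⟩

/-- If the log-density is differentiable there, continuity keeps it above `log 0 = 0` minus `1`
nearby, while the density stays below `exp (-1)`. A positive density would contradict this, so the
density vanishes near `φ` and its log is constant. Otherwise the gradient is `0` by default. -/
theorem score_eq_zero_of_density_eq_zero {φ : Vec p} (hφ : φ ∈ 𝓜.paramSet) {x : Vec D}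
    (hd : DifferentiableAt ℝ (fun φ' => 𝓜.density φ' x) φ) (h0 : 𝓜.density φ x = 0) :
    𝓜.score φ x = 0 := by
  by_cases hl : DifferentiableAt ℝ (fun φ' => Real.log (𝓜.density φ' x)) φ
  · have h1 := hl.continuousAt.tendsto
    have h2 := hd.continuousAt.tendsto
    simp only [h0, Real.log_zero] at h1 h2
    have h3 : (fun φ' => Real.log (𝓜.density φ' x)) =ᶠ[nhds φ] fun _ => 0 := by
      filter_upwards [h1.eventually (lt_mem_nhds (show (-1 : ℝ) < 0 by norm_num)),
        h2.eventually (gt_mem_nhds (Real.exp_pos (-1))),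
        𝓜.isOpen_paramSet.mem_nhds hφ] with φ' h4 h5 h6
      rcases (𝓜.density_nonneg φ' h6 x).eq_or_lt with h7 | h7
      · rw [← h7, Real.log_zero]
      · exact absurd h4 (not_lt.2 ((Real.log_lt_iff_lt_exp h7).2 h5).le)
    rw [score, h3.gradient_eq, gradient_fun_const]
  · exact gradient_eq_zero_of_not_differentiableAt hl

/-- Valid also at zeros of the density, where `0⁻¹ = 0` matches the vanishing score. This product
form makes difference quotients of the density available. -/
theorem score_apply {φ : Vec p} (hφ : φ ∈ 𝓜.paramSet) {x : Vec D}
    (hd : DifferentiableAt ℝ (fun φ' => 𝓜.density φ' x) φ) (i : Fin p) :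
    𝓜.score φ x i = (𝓜.density φ x)⁻¹ *
      fderiv ℝ (fun φ' => 𝓜.density φ' x) φ (EuclideanSpace.single i 1) := by
  by_cases h0 : 𝓜.density φ x = 0
  · simp [score_eq_zero_of_density_eq_zero hφ hd h0, h0]
  · have h1 : 𝓜.score φ x i = inner ℝ (𝓜.score φ x) (EuclideanSpace.single i 1) := by
      rw [EuclideanSpace.inner_single_right]; simp
    rw [h1, score, inner_gradient_left, fderiv.log hd h0]
    rfl

/-- Each coordinate is a pointwise limit of jointly measurable difference quotients with step `1 /
n`. The indicator is there because differentiability is known only on the parameter set; shifted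
points may leave that set harmlessly, since the density is measurable everywhere. -/
theorem measurable_indicator_score (hd : 𝓜.DifferentiableDensity) :
    Measurable ((𝓜.paramSet ×ˢ Set.univ).indicator (Function.uncurry 𝓜.score)) := by
  have hS : MeasurableSet (𝓜.paramSet ×ˢ (Set.univ : Set (Vec D))) :=
    𝓜.isOpen_paramSet.measurableSet.prod MeasurableSet.univ
  suffices h : ∀ i, Measurable ((𝓜.paramSet ×ˢ (Set.univ : Set (Vec D))).indicator
      fun q => 𝓜.score q.1 q.2 i) by
    refine (MeasurableEquiv.toLp 2 (Fin p → ℝ)).symm.measurableEmbedding.measurable_comp_iff.1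
      (measurable_pi_lambda _ fun i => ?_)
    convert h i using 1
    ext q
    by_cases hq : q ∈ 𝓜.paramSet ×ˢ (Set.univ : Set (Vec D))
    · simp [Set.indicator_of_mem hq, Function.uncurry]
    · simp [Set.indicator_of_notMem hq]
  intro i
  let e : Vec p := EuclideanSpace.single i 1
  refine measurable_of_tendsto_metrizable
    (f := fun n : ℕ => (𝓜.paramSet ×ˢ (Set.univ : Set (Vec D))).indicator fun q =>
      (𝓜.density q.1 q.2)⁻¹ *
        ((n : ℝ) • (𝓜.density (q.1 + (n : ℝ)⁻¹ • e) q.2 - 𝓜.density q.1 q.2)))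
    (fun n => ?_) (tendsto_pi_nhds.2 fun q => ?_)
  · refine Measurable.indicator ?_ hS
    have h1 : Measurable fun q : Vec p × Vec D => 𝓜.density q.1 q.2 := 𝓜.measurable_density
    have h2 : Measurable fun q : Vec p × Vec D => 𝓜.density (q.1 + (n : ℝ)⁻¹ • e) q.2 :=
      𝓜.measurable_density.comp ((measurable_fst.add_const _).prodMk measurable_snd)
    exact h1.inv.mul ((h2.sub h1).const_mul _)
  · by_cases hq : q ∈ 𝓜.paramSet ×ˢ (Set.univ : Set (Vec D))
    · simp only [Set.indicator_of_mem hq]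
      rw [score_apply hq.1 (hd q.1 hq.1 q.2) i]
      exact (((hd q.1 hq.1 q.2).hasFDerivAt.lim_real e).comp
        tendsto_natCast_atTop_atTop).const_mul _
    · simp only [Set.indicator_of_notMem hq]
      exact tendsto_const_nhds

theorem measurable_score (hd : 𝓜.DifferentiableDensity) {φ : Vec p} (hφ : φ ∈ 𝓜.paramSet) :
    Measurable (𝓜.score φ) := by
  convert (measurable_indicator_score hd).comp (measurable_prodMk_left (x := φ)) using 1
  ext x
  simp [hφ, Function.uncurry]

/-- Moves the parameter from the measure into the integrand over a fixed `σ`-finite base, as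
measurability of parameter-dependent integrals requires. The `max` covers parameters outside the
model, where the density may be negative. -/
theorem integral_law (φ : Vec p) (f : Vec D → ℝ) :
    ∫ x, f x ∂𝓜.law φ = ∫ x, max (𝓜.density φ x) 0 * f x ∂𝓜.base := by
  have hm : Measurable fun x => ENNReal.ofReal (𝓜.density φ x) :=
    (𝓜.measurable_density.comp measurable_prodMk_left).ennreal_ofReal
  rw [law, integral_withDensity_eq_integral_toReal_smul hm
    (Eventually.of_forall fun x => ENNReal.ofReal_lt_top)]
  simp [ENNReal.toReal_ofReal']

/-- The score normalized by the square root of the dimension of the observables. -/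
noncomputable def normalizedScore (𝓜 : ParametricModel p D) (φ : Vec p) (x : Vec D) : Vec p :=
  (Real.sqrt D)⁻¹ • 𝓜.score φ x

theorem measurable_normalizedScore (hd : 𝓜.DifferentiableDensity) {φ : Vec p}
    (hφ : φ ∈ 𝓜.paramSet) : Measurable (𝓜.normalizedScore φ) :=
  Measurable.const_smul (measurable_score hd hφ) (Real.sqrt D)⁻¹

theorem inv_sqrt_mul_inv_sqrt (n : ℕ) : (Real.sqrt n)⁻¹ * (Real.sqrt n)⁻¹ = (n : ℝ)⁻¹ := by
  rw [← mul_inv, Real.mul_self_sqrt n.cast_nonneg]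

theorem normalizedFisher_eq_secondMoment (φ : Vec p) :
    𝓜.normalizedFisher φ = secondMoment (𝓜.law φ) (𝓜.normalizedScore φ) := by
  ext i j
  simp only [normalizedFisher, fisher, secondMoment, normalizedScore, Matrix.smul_apply,
    Matrix.of_apply, smul_eq_mul, PiLp.smul_apply]
  rw [← integral_const_mul, ← inv_sqrt_mul_inv_sqrt]
  congr 1
  ext x
  ring

theorem smul_empiricalFisher_eq {M : ℕ} (φ : Vec p) (y : Fin M → Vec D) :
    (D : ℝ)⁻¹ • 𝓜.empiricalFisher φ y = empiricalSecondMoment (𝓜.normalizedScore φ) y := by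
  ext i j
  simp only [empiricalFisher, empiricalSecondMoment, normalizedScore, Matrix.smul_apply,
    Matrix.sum_apply, Matrix.vecMulVec_apply, smul_eq_mul, PiLp.smul_apply, Finset.mul_sum]
  refine Finset.sum_congr rfl fun k _ => ?_
  rw [← inv_sqrt_mul_inv_sqrt D]
  ring

theorem measurable_indicator_normalizedFisher (hd : 𝓜.DifferentiableDensity) :
    Measurable (𝓜.paramSet.indicator 𝓜.normalizedFisher) := by
  have := 𝓜.sigmaFinite_base
  have hsc : ∀ i, Measurable fun q =>
      ((𝓜.paramSet ×ˢ Set.univ).indicator (Function.uncurry 𝓜.score) q) i := fun i =>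
    (EuclideanSpace.proj (𝕜 := ℝ) i).continuous.measurable.comp (measurable_indicator_score hd)
  refine measurable_pi_lambda _ fun i => measurable_pi_lambda _ fun j => ?_
  have h1 : Measurable fun φ : Vec p => ∫ x, max (𝓜.density φ x) 0 *
      (((𝓜.paramSet ×ˢ Set.univ).indicator (Function.uncurry 𝓜.score) (φ, x)) i *
       ((𝓜.paramSet ×ˢ Set.univ).indicator (Function.uncurry 𝓜.score) (φ, x)) j) ∂𝓜.base := by
    have h2 : Measurable fun q : Vec p × Vec D => max (𝓜.density q.1 q.2) 0 *
        (((𝓜.paramSet ×ˢ Set.univ).indicator (Function.uncurry 𝓜.score) q) i *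
        ((𝓜.paramSet ×ˢ Set.univ).indicator (Function.uncurry 𝓜.score) q) j) :=
      (𝓜.measurable_density.max measurable_const).mul ((hsc i).mul (hsc j))
    exact (StronglyMeasurable.integral_prod_right
      (f := fun (φ : Vec p) (x : Vec D) => max (𝓜.density φ x) 0 *
      (((𝓜.paramSet ×ˢ Set.univ).indicator (Function.uncurry 𝓜.score) (φ, x)) i *
       ((𝓜.paramSet ×ˢ Set.univ).indicator (Function.uncurry 𝓜.score) (φ, x)) j))
      h2.stronglyMeasurable).measurable
  convert (h1.const_mul (D : ℝ)⁻¹).indicator 𝓜.isOpen_paramSet.measurableSet using 1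
  ext φ
  by_cases hφ : φ ∈ 𝓜.paramSet
  · simp only [Set.indicator_of_mem hφ]
    rw [normalizedFisher, Matrix.smul_apply, fisher, Matrix.of_apply, integral_law, smul_eq_mul]
    congr 2
    ext x
    simp [hφ, Function.uncurry]
  · simp only [Set.indicator_of_notMem hφ]
    rfl

theorem measurable_indicator_empiricalFisher (hd : 𝓜.DifferentiableDensity) (M : ℕ) :
    Measurable ((𝓜.paramSet ×ˢ Set.univ).indicator fun q : Vec p × (Fin M → Vec D) =>
      (D : ℝ)⁻¹ • 𝓜.empiricalFisher q.1 q.2) := by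
  have hsc : ∀ i k, Measurable fun q : Vec p × (Fin M → Vec D) =>
      ((𝓜.paramSet ×ˢ Set.univ).indicator (Function.uncurry 𝓜.score) (q.1, q.2 k)) i :=
    fun i k => (EuclideanSpace.proj (𝕜 := ℝ) i).continuous.measurable.comp
      ((measurable_indicator_score hd).comp
        (measurable_fst.prodMk ((measurable_pi_apply k).comp measurable_snd)))
  refine measurable_pi_lambda _ fun i => measurable_pi_lambda _ fun j => ?_
  have h1 : Measurable fun q : Vec p × (Fin M → Vec D) => (D : ℝ)⁻¹ * ((M : ℝ)⁻¹ * ∑ k,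
      ((𝓜.paramSet ×ˢ Set.univ).indicator (Function.uncurry 𝓜.score) (q.1, q.2 k)) i *
      ((𝓜.paramSet ×ˢ Set.univ).indicator (Function.uncurry 𝓜.score) (q.1, q.2 k)) j) :=
    ((Finset.measurable_sum _ fun k _ => (hsc i k).mul (hsc j k)).const_mul _).const_mul _
  convert h1 using 1
  ext q
  by_cases hq : q.1 ∈ 𝓜.paramSet
  · simp [hq, Function.uncurry, empiricalFisher, Matrix.sum_apply, Matrix.vecMulVec_apply]
  · simp [hq]

theorem norm_normalizedScore_le (hs : 0 < D) {C₃ : ℝ} (h : 𝓜.BoundedScore C₃) {φ : Vec p}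
    (hφ : φ ∈ 𝓜.paramSet) (x : Vec D) : ‖𝓜.normalizedScore φ x‖ ≤ Real.sqrt D * C₃ := by
  have hD : (0 : ℝ) < D := by exact_mod_cast hs
  have h1 := (h φ hφ x).le
  rw [norm_smul, Real.norm_of_nonneg (by positivity)] at h1
  rw [normalizedScore, norm_smul, Real.norm_of_nonneg (by positivity)]
  calc (Real.sqrt D)⁻¹ * ‖𝓜.score φ x‖
      = Real.sqrt D * ((D : ℝ)⁻¹ * ‖𝓜.score φ x‖) := by
        rw [← inv_sqrt_mul_inv_sqrt]
        have : Real.sqrt D ≠ 0 := (Real.sqrt_pos.2 hD).ne'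
        field_simp
    _ ≤ _ := by gcongr

theorem posSemidef_normalizedFisher (hs : 0 < D) {C₃ : ℝ} (h : 𝓜.BoundedScore C₃)
    (hd : 𝓜.DifferentiableDensity) {φ : Vec p} (hφ : φ ∈ 𝓜.paramSet) :
    (𝓜.normalizedFisher φ).PosSemidef := by
  have := isProbabilityMeasure_law hφ
  rw [normalizedFisher_eq_secondMoment]
  refine Matrix.PosSemidef.of_dotProduct_mulVec_nonneg (isHermitian_secondMoment _ _) fun u => ?_
  have h2 := dotProduct_secondMoment_mulVec (μ := 𝓜.law φ) (X := 𝓜.normalizedScore φ)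
    (measurable_normalizedScore hd hφ) (norm_normalizedScore_le hs h hφ) (WithLp.toLp 2 u)
  simp only [star_trivial]
  rw [h2]
  exact integral_nonneg fun x => sq_nonneg _

theorem isUnit_normalizedFisher (hs : 0 < D) (h : 𝓜.FisherInvertible) {φ : Vec p}
    (hφ : φ ∈ 𝓜.paramSet) : IsUnit (𝓜.normalizedFisher φ) := by
  have hD : (D : ℝ)⁻¹ ≠ 0 := inv_ne_zero (by exact_mod_cast hs.ne')
  exact (isUnit_smul_iff (Units.mk0 _ hD) (𝓜.fisher φ)).2 (h φ hφ)

open scoped Matrix.Norms.L2Operator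

/-- The event that the normalized Monte Carlo Fisher information deviates by more than `t`. -/
def fisherDeviation (𝓜 : ParametricModel p D) (M : ℕ) (t : ℝ) : Set (Vec p × (Fin M → Vec D)) :=
  {q | q.1 ∈ 𝓜.paramSet ∧
    t < ‖(D : ℝ)⁻¹ • 𝓜.empiricalFisher q.1 q.2 - 𝓜.normalizedFisher q.1‖}

theorem measurableSet_fisherDeviation (hd : 𝓜.DifferentiableDensity) (M : ℕ) (t : ℝ) :
    MeasurableSet (𝓜.fisherDeviation M t) := by
  have h1 : Measurable fun q : Vec p × (Fin M → Vec D) =>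
      (𝓜.paramSet ×ˢ Set.univ).indicator (fun q : Vec p × (Fin M → Vec D) =>
        (D : ℝ)⁻¹ • 𝓜.empiricalFisher q.1 q.2) q - 𝓜.paramSet.indicator 𝓜.normalizedFisher q.1 :=
    Measurable.sub (G := Fin p → Fin p → ℝ) (measurable_indicator_empiricalFisher hd M)
      ((measurable_indicator_normalizedFisher hd).comp measurable_fst)
  have h2 : MeasurableSet {q : Vec p × (Fin M → Vec D) | q.1 ∈ 𝓜.paramSet ∧
      t < ‖(𝓜.paramSet ×ˢ Set.univ).indicator (fun q : Vec p × (Fin M → Vec D) =>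
        (D : ℝ)⁻¹ • 𝓜.empiricalFisher q.1 q.2) q - 𝓜.paramSet.indicator 𝓜.normalizedFisher q.1‖} :=
    (measurable_fst 𝓜.isOpen_paramSet.measurableSet).inter
      (measurableSet_lt measurable_const (measurable_l2_opNorm.comp h1))
  convert h2 using 1
  ext q
  refine and_congr_right fun hq => ?_
  simp [hq]

theorem measure_fisherDeviation_le (hs : 0 < D) {C₁ C₃ : ℝ} (hC₁ : 0 < C₁)
    (hsub : 𝓜.SubGaussianScore C₁) (hb : 𝓜.BoundedScore C₃) (hd : 𝓜.DifferentiableDensity)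
    {M : ℕ} (hM : 4 * p ≤ M) (hp : 0 < p) {φ : Vec p} (hφ : φ ∈ 𝓜.paramSet) :
    (Measure.pi fun _ : Fin M => 𝓜.law φ)
      (Prod.mk φ ⁻¹' 𝓜.fisherDeviation M (40 * C₁ ^ 2 * Real.sqrt (p / M)))
      ≤ ENNReal.ofReal (2 * Real.exp (-p)) := by
  have := isProbabilityMeasure_law hφ
  refine le_trans (measure_mono fun y hy => ?_)
    (measure_norm_empiricalSecondMoment_sub_gt_le (μ := 𝓜.law φ) hM hp
      (X := 𝓜.normalizedScore φ) (measurable_normalizedScore hd hφ)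
      (norm_normalizedScore_le hs hb hφ) hC₁ (hsub φ hφ))
  have h := hy.2
  rwa [smul_empiricalFisher_eq, normalizedFisher_eq_secondMoment] at h

end ParametricModel

/-! ### From conditional bounds given the initial estimate to the joint law. -/

section OutcomeLaw

variable {p D L N M : ℕ} {P : Measure (Vec D)} [IsProbabilityMeasure P]
  {init : Kernel (Fin (N / 2) → Vec D) (Vec p)} [IsMarkovKernel init]
  {mc : Kernel (Vec p) ((Fin M → Vec D) × Matrix (Fin L) (Fin p) ℝ)} [IsMarkovKernel mc]

/-- An event about the initial estimate and the Monte Carlo output is at most as likely as its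
conditional probability given the initial estimate. -/
theorem outcomeLaw_preimage_le {S : Set (Vec p)} (hSm : MeasurableSet S)
    (hS : ∀ x, ∀ᵐ φ ∂init x, φ ∈ S) {δ : ENNReal}
    {B : Set (Vec p × ((Fin M → Vec D) × Matrix (Fin L) (Fin p) ℝ))} (hB : MeasurableSet B)
    (h : ∀ φ ∈ S, mc φ (Prod.mk φ ⁻¹' B) ≤ δ) :
    outcomeLaw P init mc {ω | (ω.1.2, ω.2) ∈ B} ≤ δ := by
  have hm : MeasurableSet {ω : Outcome p D L N M | (ω.1.2, ω.2) ∈ B} :=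
    ((measurable_snd.comp measurable_fst).prodMk measurable_snd) hB
  rw [outcomeLaw, Measure.compProd_apply hm]
  have hae : ∀ᵐ a ∂((Measure.pi fun _ : Fin N => P) ⊗ₘ
      (init.comap firstHalf measurable_firstHalf)), a.2 ∈ S :=
    Measure.ae_compProd_of_ae_ae (measurable_snd hSm)
      (Eventually.of_forall fun x => by
        rw [Kernel.comap_apply]
        exact hS _)
  calc _ ≤ ∫⁻ _, δ ∂((Measure.pi fun _ : Fin N => P) ⊗ₘ
      (init.comap firstHalf measurable_firstHalf)) := by
        refine lintegral_mono_ae ?_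
        filter_upwards [hae] with a ha
        rw [Kernel.comap_apply]
        exact h a.2 ha
    _ = δ := by simp

theorem outcomeLaw_notMem_eq_zero {S : Set (Vec p)} (hSm : MeasurableSet S)
    (hS : ∀ x, ∀ᵐ φ ∂init x, φ ∈ S) :
    outcomeLaw P init mc {ω | ω.1.2 ∉ S} = 0 := by
  refine le_antisymm (outcomeLaw_preimage_le (mc := mc) hSm hS (B := Prod.fst ⁻¹' Sᶜ)
    (measurable_fst hSm.compl) fun φ hφ => ?_) zero_le
  have : (Prod.mk φ ⁻¹' (Prod.fst ⁻¹' Sᶜ) :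
      Set ((Fin M → Vec D) × Matrix (Fin L) (Fin p) ℝ)) = ∅ := by
    ext u
    simp [hφ]
  rw [this, measure_empty]

theorem outcomeLaw_fisherDeviation_le {𝓜 : ParametricModel p D} (hs : 0 < D)
    (hinit : ∀ x, ∀ᵐ φ ∂init x, φ ∈ 𝓜.paramSet) (hmc : IsSimulator 𝓜 mc) {C₁ C₃ : ℝ}
    (hC₁ : 0 < C₁) (hsub : 𝓜.SubGaussianScore C₁) (hb : 𝓜.BoundedScore C₃)
    (hd : 𝓜.DifferentiableDensity) (hM : 4 * p ≤ M) (hp : 0 < p) :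
    outcomeLaw P init mc
      {ω | (ω.1.2, ω.2.1) ∈ 𝓜.fisherDeviation M (40 * C₁ ^ 2 * Real.sqrt (p / M))}
      ≤ ENNReal.ofReal (2 * Real.exp (-p)) := by
  refine outcomeLaw_preimage_le (mc := mc) 𝓜.isOpen_paramSet.measurableSet hinit
    (B := {q | (q.1, q.2.1) ∈ 𝓜.fisherDeviation M (40 * C₁ ^ 2 * Real.sqrt (p / M))})
    ((measurable_fst.prodMk (measurable_fst.comp measurable_snd))
      (ParametricModel.measurableSet_fisherDeviation hd M _)) fun φ hφ => ?_
  refine le_trans ?_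
    (ParametricModel.measure_fisherDeviation_le hs hC₁ hsub hb hd hM hp hφ)
  -- The event involves only the draws, so the first marginal of the Monte Carlo output suffices and
  -- the coupling with the matrix is irrelevant.
  rw [← hmc φ hφ]
  exact Measure.le_map_apply measurable_fst.aemeasurable _

theorem measurable_frobNorm {m n : ℕ} :
    Measurable (frobNorm : Matrix (Fin m) (Fin n) ℝ → ℝ) := by
  refine Measurable.sqrt (Finset.measurable_sum _ fun i _ => Finset.measurable_sum _ fun j _ => ?_)
  exact ((measurable_pi_apply j).comp
    (measurable_pi_apply (X := fun _ : Fin m => Fin n → ℝ) i)).pow_const 2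

theorem measurable_jacobian (ψ : Vec p → Vec L) : Measurable (jacobian ψ) := by
  refine measurable_pi_lambda _ fun i => measurable_pi_lambda _ fun j => ?_
  exact (EuclideanSpace.proj (𝕜 := ℝ) i).continuous.measurable.comp
    (measurable_fderiv_apply_const ℝ ψ (EuclideanSpace.single j 1))

theorem outcomeLaw_gradient_le {𝓜 : ParametricModel p D}
    (hinit : ∀ x, ∀ᵐ φ ∂init x, φ ∈ 𝓜.paramSet) {ψ : Vec p → Vec L} {C₂ : ℝ}
    (hacc : GradientAccuracy 𝓜 ψ C₂ mc) {ε : ℝ} (hε : 0 < ε) :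
    outcomeLaw P init mc {ω | Real.sqrt ((p * Real.log p + ε) / M)
        < frobNorm (jacobian ψ ω.1.2 - ω.2.2)} ≤ ENNReal.ofReal (Real.exp (-ε)) := by
  have hm : Measurable fun q : Vec p × ((Fin M → Vec D) × Matrix (Fin L) (Fin p) ℝ) =>
      frobNorm (jacobian ψ q.1 - q.2.2) :=
    measurable_frobNorm.comp (Measurable.sub (G := Fin L → Fin p → ℝ)
      ((measurable_jacobian ψ).comp measurable_fst) (measurable_snd.comp measurable_snd))
  exact outcomeLaw_preimage_le (mc := mc) 𝓜.isOpen_paramSet.measurableSet hinit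
    (B := {q | Real.sqrt ((p * Real.log p + ε) / M) < frobNorm (jacobian ψ q.1 - q.2.2)})
    (measurableSet_lt measurable_const hm) fun φ hφ => (hacc φ hφ ε hε).1.le

end OutcomeLaw

/-! ### Closed forms of the two estimators and their distance. -/

section Estimators

variable {p D J L : ℕ} {𝓜 : ParametricModel p D} {η : Measure (Vec D) → Vec J}
  {g : Vec D → Vec J → Vec L → Vec L} {m : Vec D → Vec J → Vec L}

theorem card_heldOut_pos {N : ℕ} (hN : 0 < N) :
    0 < (Finset.univ.filter fun n : Fin N => N / 2 ≤ n.val).card :=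
  Finset.card_pos.2 ⟨⟨N - 1, by omega⟩, by simp; omega⟩

/-- The prefactor `2 / N` is not the reciprocal of the held-out sample size when `N` is odd, but a
nonzero factor does not move the root, which is the true held-out average. -/
theorem orthogonalMoment_eq_zero_iff (hlin : ∀ x e θ, g x e θ = m x e - θ) {N : ℕ} (hN : 0 < N)
    (ξ : Vec D → Vec L) (x : Fin N → Vec D) (φ : Vec p) (θ : Vec L) :
    orthogonalMoment 𝓜 η g (fun x _ => ξ x) x φ θ = 0 ↔
      θ = ((Finset.univ.filter fun n : Fin N => N / 2 ≤ n.val).card : ℝ)⁻¹ •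
        ∑ n with N / 2 ≤ n.val, (m (x n) (η (𝓜.law φ)) + ξ (x n)) := by
  have hc : ((Finset.univ.filter fun n : Fin N => N / 2 ≤ n.val).card : ℝ) ≠ 0 := by
    exact_mod_cast (card_heldOut_pos hN).ne'
  have hN' : (2 : ℝ) / N ≠ 0 := by
    have : (N : ℝ) ≠ 0 := by exact_mod_cast hN.ne'
    positivity
  rw [orthogonalMoment, smul_eq_zero_iff_right hN']
  have e : ∀ n : Fin N, g (x n) (η (𝓜.law φ)) θ + ξ (x n)
      = (m (x n) (η (𝓜.law φ)) + ξ (x n)) - θ := fun n => by rw [hlin]; abel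
  simp only [e]
  rw [Finset.sum_sub_distrib, Finset.sum_const, sub_eq_zero, eq_inv_smul_iff₀ hc,
    ← Nat.cast_smul_eq_nsmul ℝ]
  exact eq_comm

theorem jacobian_momentFunctional (hlin : ∀ x e θ, g x e θ = m x e - θ)
    (hint : ∀ φ ∈ 𝓜.paramSet, Integrable (fun x => m x (η (𝓜.law φ))) (𝓜.law φ))
    {φ : Vec p} (hφ : φ ∈ 𝓜.paramSet) (θ : Vec L) :
    jacobian (momentFunctional 𝓜 η g θ) φ = jacobian (targetFunctional 𝓜 η m) φ := by
  have h : momentFunctional 𝓜 η g θ =ᶠ[nhds φ] fun φ' => targetFunctional 𝓜 η m φ' - θ := by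
    filter_upwards [𝓜.isOpen_paramSet.mem_nhds hφ] with φ' hφ'
    have := ParametricModel.isProbabilityMeasure_law hφ'
    simp only [momentFunctional, targetFunctional, hlin]
    rw [integral_sub (hint φ' hφ') (integrable_const _)]
    simp
  unfold jacobian
  rw [h.fderiv_eq, fderiv_sub_const]

theorem mem_analyticDML_iff (hlin : ∀ x e θ, g x e θ = m x e - θ)
    (hint : ∀ φ ∈ 𝓜.paramSet, Integrable (fun x => m x (η (𝓜.law φ))) (𝓜.law φ))
    {N : ℕ} (hN : 0 < N) (x : Fin N → Vec D) {φ : Vec p} (hφ : φ ∈ 𝓜.paramSet) (θ : Vec L) :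
    θ ∈ analyticDML 𝓜 η g x φ ↔
      θ = ((Finset.univ.filter fun n : Fin N => N / 2 ≤ n.val).card : ℝ)⁻¹ •
        ∑ n with N / 2 ≤ n.val, (m (x n) (η (𝓜.law φ)) +
          influence (jacobian (targetFunctional 𝓜 η m) φ) (𝓜.fisher φ) (𝓜.score φ (x n))) := by
  rw [← orthogonalMoment_eq_zero_iff hlin hN (fun x => influence
    (jacobian (targetFunctional 𝓜 η m) φ) (𝓜.fisher φ) (𝓜.score φ x)) x φ θ]
  simp only [analyticDML, Set.mem_ofPred_eq]
  unfold orthogonalMoment analyticEIF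
  simp only [jacobian_momentFunctional hlin hint hφ]

theorem mem_mcDML_iff (hlin : ∀ x e θ, g x e θ = m x e - θ)
    {N M : ℕ} (hN : 0 < N) (x : Fin N → Vec D) (φ : Vec p) (y : Fin M → Vec D)
    (G : Matrix (Fin L) (Fin p) ℝ) (θ : Vec L) :
    θ ∈ mcDML 𝓜 η g x φ y (fun _ => G) ↔
      θ = ((Finset.univ.filter fun n : Fin N => N / 2 ≤ n.val).card : ℝ)⁻¹ •
        ∑ n with N / 2 ≤ n.val, (m (x n) (η (𝓜.law φ)) +
          influence G (𝓜.empiricalFisher φ y) (𝓜.score φ (x n))) :=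
  orthogonalMoment_eq_zero_iff hlin hN (fun x => influence G (𝓜.empiricalFisher φ y)
    (𝓜.score φ x)) x φ θ

/-- Scaling the information matrix and the score by the same factor cancels. With `c = 1 / D` this
brings in the normalized Fisher matrix and the bounded vector `s / D`. -/
theorem influence_eq_toLp_mulVec (A : Matrix (Fin L) (Fin p) ℝ) {F : Matrix (Fin p) (Fin p) ℝ}
    {c : ℝ} (hc : c ≠ 0) (hF : IsUnit (c • F)) (s : Vec p) :
    influence A F s = WithLp.toLp 2 ((A * (c • F)⁻¹) *ᵥ (c • s).ofLp) := by
  have hF' : IsUnit F.det := by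
    rw [← Matrix.isUnit_iff_isUnit_det]
    exact (isUnit_smul_iff (Units.mk0 c hc) F).1 hF
  have e : (c • F)⁻¹ = c⁻¹ • F⁻¹ := Matrix.inv_smul' F (Units.mk0 c hc) hF'
  rw [influence, e, ← Matrix.mulVec_mulVec, WithLp.ofLp_smul, Matrix.mulVec_smul,
    Matrix.smul_mulVec, smul_smul, mul_inv_cancel₀ hc, one_smul]

open scoped Matrix.Norms.L2Operator in
/-- The distance between the Monte Carlo and the analytic estimates, in terms of the errors of the
gradient and of the Fisher information. -/
theorem norm_mcDML_sub_analyticDML_le (hs : 0 < D) (hlin : ∀ x e θ, g x e θ = m x e - θ)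
    (hint : ∀ φ ∈ 𝓜.paramSet, Integrable (fun x => m x (η (𝓜.law φ))) (𝓜.law φ))
    {C₂ C₃ : ℝ} (hd : 𝓜.DifferentiableDensity) (hfisher : 𝓜.FisherInvertible)
    (hb : 𝓜.BoundedScore C₃) {N M : ℕ} (hN : 0 < N) {x : Fin N → Vec D} {φ : Vec p}
    (hφ : φ ∈ 𝓜.paramSet) (hgrad : frobNorm (jacobian (targetFunctional 𝓜 η m) φ) < C₂)
    {y : Fin M → Vec D} {G : Matrix (Fin L) (Fin p) ℝ} {K t a : ℝ} (hK : 0 ≤ K)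
    (hKt : K * t ≤ 1 / 2) (hΛ : lambdaMax (𝓜.normalizedFisher φ)⁻¹ ≤ K)
    (ht : (φ, y) ∉ 𝓜.fisherDeviation M t)
    (ha : frobNorm (jacobian (targetFunctional 𝓜 η m) φ - G) ≤ a) {θan θmc : Vec L}
    (hθan : θan ∈ analyticDML 𝓜 η g x φ) (hθmc : θmc ∈ mcDML 𝓜 η g x φ y (fun _ => G)) :
    ‖θmc - θan‖ ≤ (2 * K * a + 2 * C₂ * K ^ 2 * t) * C₃ := by
  rw [mem_analyticDML_iff hlin hint hN x hφ] at hθan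
  rw [mem_mcDML_iff hlin hN] at hθmc
  have hcard : (0 : ℝ) < (Finset.univ.filter fun n : Fin N => N / 2 ≤ n.val).card := by
    exact_mod_cast card_heldOut_pos hN
  have hc : (D : ℝ)⁻¹ ≠ 0 := inv_ne_zero (by exact_mod_cast hs.ne')
  have hS : IsUnit (𝓜.normalizedFisher φ) := ParametricModel.isUnit_normalizedFisher hs hfisher hφ
  have hSK : ‖(𝓜.normalizedFisher φ)⁻¹‖ ≤ K := norm_le_of_lambdaMax_le
    (ParametricModel.posSemidef_normalizedFisher hs hb hd hφ).inv hK hΛ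
  have ht' : ‖(D : ℝ)⁻¹ • 𝓜.empiricalFisher φ y - 𝓜.normalizedFisher φ‖ ≤ t :=
    not_lt.1 fun h => ht ⟨hφ, h⟩
  have hT := (norm_inv_le_of_norm_sub_le hS hSK ht' hKt).1
  have key := norm_mul_inv_sub_mul_inv_le hS hSK ht' hKt
    ((l2_opNorm_le_frobNorm _).trans hgrad.le) ((l2_opNorm_le_frobNorm _).trans ha)
  -- The score bound is pointwise, so each summand is controlled deterministically and no averaging
  -- over the held-out data is used.
  have hterm : ∀ n : Fin N, ‖influence G (𝓜.empiricalFisher φ y) (𝓜.score φ (x n)) -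
      influence (jacobian (targetFunctional 𝓜 η m) φ) (𝓜.fisher φ) (𝓜.score φ (x n))‖
      ≤ (2 * K * a + 2 * C₂ * K ^ 2 * t) * C₃ := fun n => by
    rw [influence_eq_toLp_mulVec G hc hT, influence_eq_toLp_mulVec _ hc (F := 𝓜.fisher φ) hS,
      ← WithLp.toLp_sub, ← Matrix.sub_mulVec]
    refine (norm_toLp_mulVec_le _ _).trans ?_
    exact mul_le_mul key (hb φ hφ (x n)).le (norm_nonneg _) ((norm_nonneg _).trans key)
  rw [hθan, hθmc, ← smul_sub, ← Finset.sum_sub_distrib, norm_smul,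
    Real.norm_of_nonneg (inv_nonneg.2 hcard.le), inv_mul_le_iff₀ hcard]
  simp only [add_sub_add_left_eq_sub]
  refine (norm_sum_le _ _).trans ((Finset.sum_le_sum fun n _ => hterm n).trans ?_)
  rw [Finset.sum_const, nsmul_eq_mul]

end Estimators

/-! ### Calculus of stochastic boundedness. -/

section BigOP

variable {Ω : ℕ → Type*} [∀ N, MeasurableSpace (Ω N)] {P : ∀ N, Measure (Ω N)}

theorem IsBigOP.mono_rate {Z : ∀ N, Ω N → ℝ} {q r : ℕ → ℝ} (h : IsBigOP P Z q)
    (hr : ∀ N, 0 < r N) (hqr : q =O[atTop] r) : IsBigOP P Z r := by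
  intro ε hε
  obtain ⟨K, hK⟩ := h ε hε
  obtain ⟨c, hc⟩ := hqr.bound
  refine ⟨|K| * c, ?_⟩
  filter_upwards [hK, hc] with N h1 h2
  refine (measure_mono fun ω hω => ?_).trans h1
  refine lt_of_le_of_lt ?_ (show |K| * c * r N < |Z N ω| from hω)
  rw [Real.norm_eq_abs, Real.norm_of_nonneg (hr N).le] at h2
  calc K * q N ≤ |K| * |q N| := by rw [← abs_mul]; exact le_abs_self _
    _ ≤ |K| * (c * r N) := by gcongr
    _ = _ := by ring

theorem IsBigOP.of_abs_le_add {Z X Y : ∀ N, Ω N → ℝ} {r : ℕ → ℝ} (hX : IsBigOP P X r)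
    (hY : IsBigOP P Y r) (h : ∀ N ω, |Z N ω| ≤ |X N ω| + |Y N ω|) : IsBigOP P Z r := by
  intro ε hε
  obtain ⟨K, hK⟩ := hX (ε / 2) (by positivity)
  obtain ⟨K', hK'⟩ := hY (ε / 2) (by positivity)
  refine ⟨K + K', ?_⟩
  filter_upwards [hK, hK'] with N h1 h2
  calc P N {ω | (K + K') * r N < |Z N ω|}
      ≤ P N ({ω | K * r N < |X N ω|} ∪ {ω | K' * r N < |Y N ω|}) := by
        refine measure_mono fun ω hω => ?_
        by_contra hn
        simp only [Set.mem_union, Set.mem_ofPred_eq, not_or, not_lt] at hn hω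
        linarith [h N ω, hn.1, hn.2, add_mul K K' (r N)]
    _ ≤ ENNReal.ofReal (ε / 2) + ENNReal.ofReal (ε / 2) :=
        (measure_union_le _ _).trans (add_le_add h1 h2)
    _ = ENNReal.ofReal ε := by
        rw [← ENNReal.ofReal_add (by positivity) (by positivity), add_halves]

theorem isBigOP_norm_sub_iff {E : Type*} [SeminormedAddCommGroup E] {X Y : ∀ N, Ω N → E}
    {c : ℕ → E} {r : ℕ → ℝ} (h : IsBigOP P (fun N ω => ‖Y N ω - X N ω‖) r) :
    IsBigOP P (fun N ω => ‖X N ω - c N‖) r ↔ IsBigOP P (fun N ω => ‖Y N ω - c N‖) r := by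
  constructor <;> intro h'
  · refine h.of_abs_le_add h' fun N ω => ?_
    simp only [abs_norm]
    exact norm_sub_le_norm_sub_add_norm_sub _ _ _
  · refine h.of_abs_le_add h' fun N ω => ?_
    simp only [abs_norm]
    rw [norm_sub_rev (Y N ω)]
    exact norm_sub_le_norm_sub_add_norm_sub _ _ _

end BigOP

/-! ### Growth of `p` and `M`. -/

section Asymptotics

theorem tendsto_natCast_of_log_isBigO {p : ℕ → ℕ}
    (hp : (fun N : ℕ => Real.log N) =O[atTop] (fun N => (p N : ℝ))) :
    Tendsto (fun N => (p N : ℝ)) atTop atTop := by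
  obtain ⟨c, hc, hb⟩ := hp.exists_pos
  have h1 : Tendsto (fun N : ℕ => Real.log N) atTop atTop :=
    Real.tendsto_log_atTop.comp tendsto_natCast_atTop_atTop
  have h2 : Tendsto (fun N => c * (p N : ℝ)) atTop atTop := by
    refine tendsto_atTop_mono' _ ?_ h1
    filter_upwards [hb.bound] with N hN
    rw [Real.norm_eq_abs, Real.norm_of_nonneg (Nat.cast_nonneg _)] at hN
    exact (le_abs_self _).trans hN
  exact (tendsto_const_mul_atTop_of_pos hc).1 h2

/-- The order of the number of draws controls `p / M` and `p log p / M` by `1 / N`. -/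
theorem eventually_draws_bound {p M : ℕ → ℕ}
    (hM : (fun N : ℕ => (N : ℝ) * p N * Real.log (p N)) =O[atTop] (fun N => (M N : ℝ)))
    (hp : Tendsto (fun N => (p N : ℝ)) atTop atTop) :
    ∃ c > 0, ∀ᶠ N : ℕ in atTop, 0 < N ∧ 0 < M N ∧ (p N : ℝ) / M N ≤ c / N ∧ ∀ ε, 0 < ε →
      (p N * Real.log (p N) + ε) / M N ≤ c * (1 + ε) / N := by
  obtain ⟨c, hc, hb⟩ := hM.exists_pos
  refine ⟨c, hc, ?_⟩
  filter_upwards [hb.bound, eventually_gt_atTop 0, hp.eventually_ge_atTop (Real.exp 1)]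
    with N h1 hN h2
  have hNR : (0 : ℝ) < N := by exact_mod_cast hN
  have hp1 : (1 : ℝ) ≤ p N := (Real.one_le_exp zero_le_one).trans h2
  have hlog : 1 ≤ Real.log (p N) := by
    rw [Real.le_log_iff_exp_le (by linarith)]; exact h2
  rw [Real.norm_of_nonneg (by positivity), Real.norm_of_nonneg (Nat.cast_nonneg _)] at h1
  -- Eventually `p ≥ e`, so `p log p ≥ 1` absorbs the additive `ε` into the factor `1 + ε`.
  have hpl : 1 ≤ p N * Real.log (p N) := one_le_mul_of_one_le_of_one_le hp1 hlog
  have hMpos : (0 : ℝ) < M N := by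
    have : 0 < (N : ℝ) * p N * Real.log (p N) := by positivity
    exact pos_of_mul_pos_right (this.trans_le h1) hc.le
  refine ⟨hN, by exact_mod_cast hMpos, ?_, fun ε hε => ?_⟩
  · rw [div_le_div_iff₀ hMpos hNR]
    calc (p N : ℝ) * N = N * p N * 1 := by ring
      _ ≤ N * p N * Real.log (p N) := by gcongr
      _ ≤ _ := h1
  · rw [div_le_div_iff₀ hMpos hNR]
    calc (p N * Real.log (p N) + ε) * N
        ≤ (p N * Real.log (p N) + ε * (p N * Real.log (p N))) * N := by
          gcongr; exact le_mul_of_one_le_right hε.le hpl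
      _ = (1 + ε) * (N * p N * Real.log (p N)) := by ring
      _ ≤ (1 + ε) * (c * M N) := by gcongr
      _ = _ := by ring

end Asymptotics

/-! ### The main theorem. -/

theorem mainTheorem3
    -- dimension of the target, and for each sample size `N` the dimensions of the parameter,
    -- of the observables and of the nuisance, and the number of Monte Carlo draws
    (L : ℕ) (p D J M : ℕ → ℕ) (hD : ∀ N, 0 < D N)
    -- model, nuisance functional and estimating equations
    (𝓜 : ∀ N, ParametricModel (p N) (D N))
    (η : ∀ N, Measure (Vec (D N)) → Vec (J N))
    (g : ∀ N, Vec (D N) → Vec (J N) → Vec L → Vec L)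
    (m : ∀ N, Vec (D N) → Vec (J N) → Vec L)
    -- the estimating equations are linear
    (hlin : ∀ N x e θ, g N x e θ = m N x e - θ)
    (hint : ∀ N, ∀ φ ∈ (𝓜 N).paramSet,
      Integrable (fun x => m N x (η N ((𝓜 N).law φ))) ((𝓜 N).law φ))
    -- data-generating distribution, its closest distribution in the model, and the estimand
    (P : ∀ N, Measure (Vec (D N))) [∀ N, IsProbabilityMeasure (P N)]
    (φstar : ∀ N, Vec (p N)) (hφstar : ∀ N, φstar N ∈ (𝓜 N).paramSet)
    (hKL : ∀ N, IsMinOn (fun φ => InformationTheory.klDiv (P N) ((𝓜 N).law φ))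
      (𝓜 N).paramSet (φstar N))
    (θstar : ∀ N, Vec L)
    (hθstar : ∀ N θ, ∫ x, g N x (η N ((𝓜 N).law (φstar N))) θ ∂(𝓜 N).law (φstar N) = 0 ↔
      θ = θstar N)
    -- initial estimator and Monte Carlo procedure
    (init : ∀ N, Kernel (Fin (N / 2) → Vec (D N)) (Vec (p N))) [∀ N, IsMarkovKernel (init N)]
    (hinit : ∀ N x, ∀ᵐ φ ∂init N x, φ ∈ (𝓜 N).paramSet)
    (mc : ∀ N k, Kernel (Vec (p N)) ((Fin k → Vec (D N)) × Matrix (Fin L) (Fin (p N)) ℝ))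
    [∀ N k, IsMarkovKernel (mc N k)]
    (hmc : ∀ N k, IsSimulator (𝓜 N) (mc N k))
    -- assumptions on model and functional, with constants that do not depend on `N`
    (hdens : ∀ N, (𝓜 N).DifferentiableDensity)
    (hψ : ∀ N, ∀ φ ∈ (𝓜 N).paramSet,
      DifferentiableAt ℝ (targetFunctional (𝓜 N) (η N) (m N)) φ)
    (hfisher : ∀ N, (𝓜 N).FisherInvertible)
    (C₁ C₂ C₃ Cψ : ℝ) (hC₁ : 0 < C₁)
    (hsub : ∀ N, (𝓜 N).SubGaussianScore C₁)
    (hgrad : ∀ N, ∀ φ ∈ (𝓜 N).paramSet,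
      frobNorm (jacobian (targetFunctional (𝓜 N) (η N) (m N)) φ) < C₂)
    (hscore : ∀ N, (𝓜 N).BoundedScore C₃)
    (hacc : ∀ N k : ℕ, Cψ < k →
      GradientAccuracy (𝓜 N) (targetFunctional (𝓜 N) (η N) (m N)) C₂ (mc N k))
    -- conditioning of the normalized Fisher information at the initial estimate
    (hΛ : IsBigOP (fun N => outcomeLaw (P N) (init N) (mc N (M N)))
      (fun N ω => lambdaMax ((𝓜 N).normalizedFisher ω.1.2)⁻¹) (fun _ => 1))
    -- `M` is of order at least `N p log p`, and `p` of order at least `log N`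
    (hM : (fun N : ℕ => (N : ℝ) * p N * Real.log (p N)) =O[atTop] (fun N => (M N : ℝ)))
    (hp : (fun N : ℕ => Real.log N) =O[atTop] (fun N => (p N : ℝ))) :
    -- both algorithms return exactly one point
    (∀ N, 0 < N → ∀ ω : Outcome (p N) (D N) L N (M N), ω.1.2 ∈ (𝓜 N).paramSet →
      (∃! θ, θ ∈ analyticDML (𝓜 N) (η N) (g N) ω.1.1 ω.1.2) ∧
      (∃! θ, θ ∈ mcDML (𝓜 N) (η N) (g N) ω.1.1 ω.1.2 ω.2.1 (fun _ => ω.2.2))) ∧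
    -- and these points converge to `θstar` at the same rate
    ∀ θan θmc : ∀ N, Outcome (p N) (D N) L N (M N) → Vec L,
      (∀ N, 0 < N → ∀ ω : Outcome (p N) (D N) L N (M N), ω.1.2 ∈ (𝓜 N).paramSet →
        θan N ω ∈ analyticDML (𝓜 N) (η N) (g N) ω.1.1 ω.1.2 ∧
        θmc N ω ∈ mcDML (𝓜 N) (η N) (g N) ω.1.1 ω.1.2 ω.2.1 (fun _ => ω.2.2)) →
      IsBigOP (fun N => outcomeLaw (P N) (init N) (mc N (M N)))
        (fun N ω => ‖θmc N ω - θan N ω‖) (fun N => 1 / Real.sqrt N) ∧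
      ∀ r : ℕ → ℝ, (∀ N, 0 < r N) →
        (fun N : ℕ => 1 / Real.sqrt N) =O[atTop] r →
        (IsBigOP (fun N => outcomeLaw (P N) (init N) (mc N (M N)))
            (fun N ω => ‖θan N ω - θstar N‖) r ↔
          IsBigOP (fun N => outcomeLaw (P N) (init N) (mc N (M N)))
            (fun N ω => ‖θmc N ω - θstar N‖) r) := by
  have hp' := tendsto_natCast_of_log_isBigO hp
  obtain ⟨c, hc, hcN⟩ := eventually_draws_bound hM hp'
  refine ⟨fun N hN ω hω => ⟨?_, ?_⟩, fun θan θmc hθ => ?_⟩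
  · simp only [mem_analyticDML_iff (hlin N) (hint N) hN ω.1.1 hω]
    exact existsUnique_eq
  · simp only [mem_mcDML_iff (hlin N) hN]
    exact existsUnique_eq
  have hdiff : IsBigOP (fun N => outcomeLaw (P N) (init N) (mc N (M N)))
      (fun N ω => ‖θmc N ω - θan N ω‖) (fun N => 1 / Real.sqrt N) := by
    intro ε hε
    -- The budget `ε` is shared equally by ill-conditioning, Fisher deviation and Jacobian error;
    -- leaving the parameter set has probability zero.
    obtain ⟨K₀, hK₀⟩ := hΛ (ε / 3) (by positivity)
    set K := max K₀ 1 with hKdef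
    have hK1 : 1 ≤ K := le_max_right _ _
    have hK0 : 0 ≤ K := zero_le_one.trans hK1
    -- Tail level for the Jacobian error, fixed as `N` grows: `exp (-δ) ≤ ε / 3`, and the `1` keeps
    -- it positive.
    set δ := max 1 (Real.log (3 / ε)) with hδ
    have hδ0 : 0 < δ := lt_of_lt_of_le one_pos (le_max_left _ _)
    have hδε : Real.exp (-δ) ≤ ε / 3 := by
      rw [Real.exp_neg]
      refine inv_le_of_inv_le₀ (by positivity) ?_
      rw [inv_div]
      calc 3 / ε = Real.exp (Real.log (3 / ε)) := (Real.exp_log (by positivity)).symm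
        _ ≤ Real.exp δ := Real.exp_le_exp.2 (le_max_right _ _)
    refine ⟨(2 * K * Real.sqrt (c * (1 + δ)) +
      2 * C₂ * K ^ 2 * (40 * C₁ ^ 2 * Real.sqrt c)) * C₃, ?_⟩
    have hexp : Tendsto (fun N => 2 * Real.exp (-(p N : ℝ))) atTop (nhds 0) := by
      simpa using (Real.tendsto_exp_neg_atTop_nhds_zero.comp hp').const_mul 2
    have hN1 : Tendsto (fun N : ℕ => c / (N : ℝ)) atTop (nhds 0) :=
      tendsto_const_nhds.div_atTop tendsto_natCast_atTop_atTop
    have hKt : Tendsto (fun N : ℕ => K * (40 * C₁ ^ 2 * Real.sqrt (c / N))) atTop (nhds 0) := by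
      simpa using ((hN1.sqrt).const_mul (40 * C₁ ^ 2)).const_mul K
    filter_upwards [hcN, hK₀, hexp.eventually (gt_mem_nhds (show 0 < ε / 3 by positivity)),
      hN1.eventually (gt_mem_nhds (show (0 : ℝ) < 1 / 4 by norm_num)),
      hKt.eventually (gt_mem_nhds (show (0 : ℝ) < 1 / 2 by norm_num)),
      hp'.eventually_gt_atTop (max Cψ 0)] with N ⟨hN, hMpos, hpM, hgM⟩ hK₀N hexpN hcN4 hKtN hpN
    have hp0 : 0 < p N := by exact_mod_cast (le_max_right _ _).trans_lt hpN
    have hMR : (0 : ℝ) < M N := by exact_mod_cast hMpos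
    have h4 : 4 * (p N : ℝ) ≤ M N := by
      have := hpM.trans hcN4.le
      rw [div_le_iff₀ hMR] at this
      linarith
    -- The number of draws eventually exceeds the accuracy threshold, since `Cψ < p` and `4 p ≤ M`.
    have hCψ : Cψ < M N := by
      have : (0 : ℝ) < p N := by exact_mod_cast hp0
      linarith [(le_max_left Cψ 0).trans_lt hpN]
    set t := 40 * C₁ ^ 2 * Real.sqrt (p N / M N) with ht
    have htN : t ≤ 40 * C₁ ^ 2 * Real.sqrt (c / N) := by
      rw [ht]; gcongr
    have hKtN' : K * t ≤ 1 / 2 := (mul_le_mul_of_nonneg_left htN hK0).trans hKtN.le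
    set a := Real.sqrt ((p N * Real.log (p N) + δ) / M N) with ha
    have haN : a ≤ Real.sqrt (c * (1 + δ) / N) := Real.sqrt_le_sqrt (hgM δ hδ0)
    have hdev := outcomeLaw_fisherDeviation_le (P := P N) (hD N) (hinit N) (hmc N (M N)) hC₁
      (hsub N) (hscore N) (hdens N) (by exact_mod_cast h4) hp0
    have hgr := outcomeLaw_gradient_le (P := P N) (hinit N) (hacc N (M N) hCψ) hδ0
    have hout := outcomeLaw_notMem_eq_zero (P := P N) (mc := mc N (M N))
      (𝓜 N).isOpen_paramSet.measurableSet (hinit N)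
    -- The parameter set is nonempty because it contains `φstar N`; evaluating the bounds there
    -- gives the signs of the constants.
    have hC₂ : 0 ≤ C₂ := (Real.sqrt_nonneg _).trans (hgrad N _ (hφstar N)).le
    have hC₃ : 0 ≤ C₃ := (norm_nonneg _).trans (hscore N _ (hφstar N) 0).le
    have hbound : (2 * K * a + 2 * C₂ * K ^ 2 * t) * C₃ ≤
        (2 * K * Real.sqrt (c * (1 + δ)) + 2 * C₂ * K ^ 2 * (40 * C₁ ^ 2 * Real.sqrt c)) * C₃ *
          (1 / Real.sqrt N) := by
      rw [Real.sqrt_div (by positivity)] at htN haN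
      calc (2 * K * a + 2 * C₂ * K ^ 2 * t) * C₃
          ≤ (2 * K * (Real.sqrt (c * (1 + δ)) / Real.sqrt N) +
              2 * C₂ * K ^ 2 * (40 * C₁ ^ 2 * (Real.sqrt c / Real.sqrt N))) * C₃ := by gcongr
        _ = _ := by ring
    refine (measure_mono (t := ({ω | ω.1.2 ∉ (𝓜 N).paramSet} ∪
      {ω | K₀ * 1 < |lambdaMax ((𝓜 N).normalizedFisher ω.1.2)⁻¹|}) ∪
      ({ω | (ω.1.2, ω.2.1) ∈ (𝓜 N).fisherDeviation (M N) t} ∪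
      {ω | a < frobNorm (jacobian (targetFunctional (𝓜 N) (η N) (m N)) ω.1.2 - ω.2.2)}))
      fun ω hω => ?_).trans ?_
    · by_contra hn
      simp only [Set.mem_union, Set.mem_ofPred_eq, not_or, not_not, not_lt, mul_one] at hn
      obtain ⟨⟨h1, h2⟩, h3, h5⟩ := hn
      have hle := norm_mcDML_sub_analyticDML_le (hD N) (hlin N) (hint N) (hdens N) (hfisher N)
        (hscore N) hN h1 (hgrad N _ h1) hK0 hKtN'
        ((le_abs_self _).trans (h2.trans (le_max_left _ _))) h3 h5 (hθ N hN ω h1).1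
        (hθ N hN ω h1).2
      simp only [Set.mem_ofPred_eq, abs_norm] at hω
      exact absurd (hle.trans hbound) (not_le.2 hω)
    · calc _ ≤ (0 + ENNReal.ofReal (ε / 3)) + (ENNReal.ofReal (ε / 3) + ENNReal.ofReal (ε / 3)) := by
            refine (measure_union_le _ _).trans (add_le_add ?_ ?_)
            · exact (measure_union_le _ _).trans (add_le_add hout.le hK₀N)
            · exact (measure_union_le _ _).trans (add_le_add
                (hdev.trans (ENNReal.ofReal_le_ofReal hexpN.le))
                (hgr.trans (ENNReal.ofReal_le_ofReal hδε)))
        _ = ENNReal.ofReal ε := by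
            rw [zero_add, ← ENNReal.ofReal_add (by positivity) (by positivity),
              ← ENNReal.ofReal_add (by positivity) (by positivity)]
            congr 1
            ring
  exact ⟨hdiff, fun r hr hqr => isBigOP_norm_sub_iff (hdiff.mono_rate hr hqr)⟩
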